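/- For $x>1$ put $s(x)=\sqrt{x^2-1}$. Consider planar central configurations of the Newtonian 4-body problem with $q_1=(-1,0)$, $q_2=(1,0)$, $q_3=(0,s(a))$, $q_4=(0,s(b))$ and masses $m_1=m_2=1$, $m_3=m_4=m>0$. Away from the zeros of the denominators below, their equations reduce to $G(r,m)=0$, where $r=(a,b)$, $G(r,m)=\bigl(m-h_1(a,b),\,m-h_2(a,b)\bigr)$ and $$h_1(a,b)=-\frac{b^3\,s(a)\,(a^3-8)\,(s(a)-s(b))^2}{4a^3\,\bigl(b^3+(s(a)-s(b))^3\bigr)},\qquad h_2(a,b)=\frac{a^3\,s(b)\,(b^3-8)\,(s(a)-s(b))^2}{4b^3\,\bigl(a^3+(s(a)-s(b))^3\bigr)}.$$ Let $\Omega$ be the set of $(r,m)$ with $a,b>1$, $m>0$ and both denominators nonzero, let $J_G$ be the Jacobian matrix of $G$ with respect to $r$, $D^2G$ its second derivative with respect to $r$, and $G_m=\partial G/\partial m$. Call $(r,m)\in\Omega$ a bifurcation point if $G(r,m)=0$ and there are no neighbourhoods $U$ of $r$ and $V$ of $m$ such that for every $\mu\in V$ the equation $G(\cdot,\mu)=0$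 has exactly one solution in $U$ and this solution depends continuously on $\mu\in V$. Call a solution $(r,m)$ a fold point if $G$ is smooth near it, $0$ is an (algebraically) simple eigenvalue of $J_G(r,m)$, and there are nonzero vectors $v,w$ with $J_Gv=0$, $J_G^Tw=0$, $w^TG_m\neq0$ and $w^TD^2G(v,v)\neq0$ at $(r,m)$. Then there is a point $(r_0,m_0)\in\Omega$, with $r_0=(a_0,b_0)\approx(1.17338,\,2.03699)$ and $m_0\approx1.00271$ (each value correct to within $5\cdot10^{-6}$), such that: 1. $(r_0,m_0)$ is the only solution of $G(r,m)=0$ in $\Omega$ at which $\det J_G(r,m)=0$; 2. $(r_0,m_0)$ is a fold point; 3. $(r_0,m_0)$ is the only bifurcation point in $\Omega$. -/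

import Mathlib

open scoped Topology ContDiff Matrix

noncomputable section

namespace ParamSystem

variable {N : ℕ}

/-- The Jacobian matrix `DF(x, μ)` of `F(·, μ)` at `x`, for a system `F(x, μ) = 0` with state
`x ∈ ℝ^N` and parameter `μ ∈ ℝ`. -/
def jacobian (F : (Fin N → ℝ) → ℝ → (Fin N → ℝ)) (x : Fin N → ℝ) (μ : ℝ) :
    Matrix (Fin N) (Fin N) ℝ :=
  LinearMap.toMatrix' (fderiv ℝ (fun y => F y μ) x : (Fin N → ℝ) →ₗ[ℝ] (Fin N → ℝ))

/-- The vector `F_μ(x, μ)` of partial derivatives with respect to the parameter. -/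
def paramDeriv (F : (Fin N → ℝ) → ℝ → (Fin N → ℝ)) (x : Fin N → ℝ) (μ : ℝ) : Fin N → ℝ :=
  deriv (fun t => F x t) μ

/-- The vector `D²F(x, μ)(u, v)`: second derivative in the state variable. -/
def secondDeriv (F : (Fin N → ℝ) → ℝ → (Fin N → ℝ)) (x : Fin N → ℝ) (μ : ℝ)
    (u v : Fin N → ℝ) : Fin N → ℝ :=
  fderiv ℝ (fun y => fderiv ℝ (fun z => F z μ) y) x u v

/-- `(x₀, μ₀)` is a fold bifurcation point of `F(x, μ) = 0`: a solution near which `F` is smooth,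
at which the Jacobian has the (algebraically) simple eigenvalue `0`, with eigenvector `v` and
adjoint eigenvector `w`, such that `wᵀ F_μ ≠ 0` and `wᵀ D²F(v, v) ≠ 0`. -/
structure IsFoldPoint (F : (Fin N → ℝ) → ℝ → (Fin N → ℝ)) (x₀ : Fin N → ℝ) (μ₀ : ℝ) :
    Prop where
  smooth : ContDiffAt ℝ ∞ (fun p : (Fin N → ℝ) × ℝ => F p.1 p.2) (x₀, μ₀)
  isSolution : F x₀ μ₀ = 0
  simple_zero : (jacobian F x₀ μ₀).charpoly.rootMultiplicity 0 = 1
  nondegenerate : ∃ v w : Fin N → ℝ, v ≠ 0 ∧ w ≠ 0 ∧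
    jacobian F x₀ μ₀ *ᵥ v = 0 ∧ (jacobian F x₀ μ₀)ᵀ *ᵥ w = 0 ∧
    w ⬝ᵥ paramDeriv F x₀ μ₀ ≠ 0 ∧ w ⬝ᵥ secondDeriv F x₀ μ₀ v v ≠ 0

/-- `(x₀, μ₀)` is a bifurcation point of `F(x, μ) = 0`: it is a solution, and there are no
neighbourhoods `U` of `x₀` and `V` of `μ₀` such that for every `μ ∈ V` the equation has exactly one
solution `x = φ(μ)` in `U`, depending continuously on `μ`. -/
def IsBifurcationPoint (F : (Fin N → ℝ) → ℝ → (Fin N → ℝ)) (x₀ : Fin N → ℝ) (μ₀ : ℝ) : Prop :=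
  F x₀ μ₀ = 0 ∧
    ¬ ∃ U ∈ 𝓝 x₀, ∃ V ∈ 𝓝 μ₀, ∃ φ : ℝ → (Fin N → ℝ),
      ContinuousOn φ V ∧ Set.MapsTo φ V U ∧ ∀ μ ∈ V, ∀ x ∈ U, F x μ = 0 ↔ x = φ μ

end ParamSystem

namespace ConcaveKite

/-- The height `√(x² - 1)` over the base of an apex at distance `x` from both base points
`(-1, 0)` and `(1, 0)`. -/
def ht (x : ℝ) : ℝ := Real.sqrt (x ^ 2 - 1)

/-- Denominator factor of `h₁`. -/
def den₁ (a b : ℝ) : ℝ := b ^ 3 + (ht a - ht b) ^ 3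

/-- Denominator factor of `h₂`. -/
def den₂ (a b : ℝ) : ℝ := a ^ 3 + (ht a - ht b) ^ 3

def h₁ (a b : ℝ) : ℝ :=
  -(b ^ 3 * ht a * (a ^ 3 - 8) * (ht a - ht b) ^ 2) / (4 * a ^ 3 * den₁ a b)

def h₂ (a b : ℝ) : ℝ :=
  (a ^ 3 * ht b * (b ^ 3 - 8) * (ht a - ht b) ^ 2) / (4 * b ^ 3 * den₂ a b)

/-- The reduced symmetric system `G(r, m) = (m - h₁(a, b), m - h₂(a, b))` with `r = (a, b)`. -/
def G (r : Fin 2 → ℝ) (m : ℝ) : Fin 2 → ℝ := ![m - h₁ (r 0) (r 1), m - h₂ (r 0) (r 1)]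

/-- The pairs `(r, m)`, `r = (a, b)`, with `a, b > 1` and `m > 0` at which `G` is defined, that is,
at which no denominator vanishes. -/
def domain : Set ((Fin 2 → ℝ) × ℝ) :=
  {p | 1 < p.1 0 ∧ 1 < p.1 1 ∧ 0 < p.2 ∧ den₁ (p.1 0) (p.1 1) ≠ 0 ∧ den₂ (p.1 0) (p.1 1) ≠ 0}

end ConcaveKite

end

/-! Solving `G = 0` means `h₁ = h₂ = m`. In the heights x = s(a), y = s(b), with d = y - x, one has
`h₁` = k d²/(4e) and `h₂` = q d²/(4f), so that, the mass being eliminated, solutions lie on the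
plane curve `phi` = kf - qe = 0. On this curve, and for d ≠ 0, det J is a nonzero multiple of an
explicit function `s`. Degenerate solutions are thus common zeros of `phi` and `s`.

Positivity of the mass confines the solutions to a bounded region (`solution_bounds`). There,
interval arithmetic with bisection excludes degenerate solutions outside a small box
(`cover_regularOrFold`, `inFoldBox_of_phi_eq_zero`). Inside the box the interval enclosure of D(phi,
s) is nonsingular, so there is at most one common zero (`InFoldBox.eq`); sign changes on the edges
of a much smaller box give one (`exists_zero`) together with its numerical location.

The same transversality settles the bifurcation. The vector adj(DH)(1, 1), where H = (h₁, h₂), is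
tangent to `phi` = 0, hence det DH has a nonzero derivative along it (`fderiv_det_ne_zero`). For a
planar system μ = H(x) this condition and a nonzero trace give a fold (`isFoldPoint_of_deriv_det`).
It also rules out a continuous solution branch, along which the square of the determinant would have
to pass strictly monotonically through 0 (`isBifurcationPoint_of_fold`). At all other solutions the
inverse function theorem provides a unique branch (`not_isBifurcationPoint`). -/

/-! ### Fixed-point interval arithmetic -/

/-- The ring operations on a carrier `R`, with a map from the integers. -/
structure RingOps (R : Type*) where
  cst : ℤ → R
  add : R → R → R
  sub : R → R → R
  mul : R → R → R

/-- The relation `ρ` is respected by the operations. -/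
structure RingOps.Rel {R R' : Type*} (O : RingOps R) (O' : RingOps R') (ρ : R → R' → Prop) :
    Prop where
  cst : ∀ n, ρ (O.cst n) (O'.cst n)
  add : ∀ {x x' y y'}, ρ x x' → ρ y y' → ρ (O.add x y) (O'.add x' y')
  sub : ∀ {x x' y y'}, ρ x x' → ρ y y' → ρ (O.sub x y) (O'.sub x' y')
  mul : ∀ {x x' y y'}, ρ x x' → ρ y y' → ρ (O.mul x y) (O'.mul x' y')

/-- Closed intervals with integer end points, to be read in units of some `1 / P`. -/
structure IntervalZ where
  lo : ℤ
  hi : ℤ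

/-- The real number `z` lies in the interval `I` with unit `1 / P`. -/
def IntervalZ.Mem (P : ℤ) (z : ℝ) (I : IntervalZ) : Prop := (I.lo : ℝ) ≤ z * P ∧ z * P ≤ I.hi

namespace IntervalZ

/-- The smaller of two integers, in a form that the kernel evaluates quickly. -/
def imin (a b : ℤ) : ℤ :=
  match b - a with
  | .ofNat _ => a
  | .negSucc _ => b

/-- The larger of two integers, in a form that the kernel evaluates quickly. -/
def imax (a b : ℤ) : ℤ :=
  match b - a with
  | .ofNat _ => b
  | .negSucc _ => a

theorem imin_eq (a b : ℤ) : imin a b = min a b := by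
  unfold imin
  split <;> rename_i n h
  · have : 0 ≤ b - a := h ▸ Int.natCast_nonneg n
    omega
  · have : b - a < 0 := h ▸ Int.negSucc_lt_zero n
    omega

theorem imax_eq (a b : ℤ) : imax a b = max a b := by
  unfold imax
  split <;> rename_i n h
  · have : 0 ≤ b - a := h ▸ Int.natCast_nonneg n
    omega
  · have : b - a < 0 := h ▸ Int.negSucc_lt_zero n
    omega

/-- Outward rounded product of fixed-point intervals with unit `1 / P`. -/
def mul (P : ℤ) (I J : IntervalZ) : IntervalZ :=
  match I.lo, J.lo with
  | .ofNat a, .ofNat b => ⟨.ofNat a * .ofNat b / P, -(-(I.hi * J.hi) / P)⟩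
  | a, b => ⟨imin (imin (a * b) (a * J.hi)) (imin (I.hi * b) (I.hi * J.hi)) / P,
    -(-(imax (imax (a * b) (a * J.hi)) (imax (I.hi * b) (I.hi * J.hi))) / P)⟩

/-- Fixed-point interval arithmetic with unit `1 / P`. -/
def ops (P : ℤ) : RingOps IntervalZ where
  cst n := ⟨n * P, n * P⟩
  add I J := ⟨I.lo + J.lo, I.hi + J.hi⟩
  sub I J := ⟨I.lo - J.hi, I.hi - J.lo⟩
  mul := mul P

theorem ediv_cast_le {P : ℤ} (hP : 0 < P) (a : ℤ) : ((a / P : ℤ) : ℝ) ≤ (a : ℝ) / P := by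
  rw [le_div_iff₀ (by exact_mod_cast hP)]
  exact_mod_cast Int.ediv_mul_le a hP.ne'

theorem le_neg_ediv_cast {P : ℤ} (hP : 0 < P) (a : ℤ) :
    (a : ℝ) / P ≤ ((-(-a / P) : ℤ) : ℝ) := by
  have := ediv_cast_le hP (-a)
  push_cast at this ⊢
  rw [neg_div] at this
  linarith

theorem mul_mem_of_bounds {P : ℤ} (hP : 0 < P) {z w : ℝ} {l h : ℤ}
    (hl : (l : ℝ) ≤ (z * P) * (w * P)) (hh : (z * P) * (w * P) ≤ h) :
    Mem P (z * w) ⟨l / P, -(-h / P)⟩ := by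
  have hP' : (0 : ℝ) < P := by exact_mod_cast hP
  have e : z * w * P = (z * P) * (w * P) / P := by field_simp
  refine ⟨(ediv_cast_le hP l).trans ?_, le_trans ?_ (le_neg_ediv_cast hP h)⟩
  · rw [e]; gcongr
  · rw [e]; gcongr

/-- The product is affine in each factor, so its extremes over a rectangle occur at the corners. -/
theorem mul_bounds {a b c d x y : ℝ} (ha : a ≤ x) (hb : x ≤ b) (hc : c ≤ y) (hd : y ≤ d) :
    min (min (a * c) (a * d)) (min (b * c) (b * d)) ≤ x * y ∧
      x * y ≤ max (max (a * c) (a * d)) (max (b * c) (b * d)) := by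
  have key : ∀ u : ℝ, min (u * c) (u * d) ≤ u * y ∧ u * y ≤ max (u * c) (u * d) := fun u => by
    rcases le_total 0 u with h | h
    · exact ⟨(min_le_left _ _).trans (by gcongr), le_trans (by gcongr) (le_max_right _ _)⟩
    · exact ⟨(min_le_right _ _).trans (mul_le_mul_of_nonpos_left hd h),
        le_trans (mul_le_mul_of_nonpos_left hc h) (le_max_left _ _)⟩
  rcases le_total 0 y with h | h
  · exact ⟨(min_le_left _ _).trans ((key a).1.trans (by gcongr)),
      le_trans (by gcongr) ((key b).2.trans (le_max_right _ _))⟩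
  · exact ⟨(min_le_right _ _).trans ((key b).1.trans (mul_le_mul_of_nonpos_right hb h)),
      le_trans (mul_le_mul_of_nonpos_right ha h) ((key a).2.trans (le_max_left _ _))⟩

theorem mul_mem {P : ℤ} (hP : 0 < P) {z w : ℝ} {I J : IntervalZ} (hz : Mem P z I)
    (hw : Mem P w J) : Mem P (z * w) (mul P I J) := by
  obtain ⟨a, a'⟩ := I
  obtain ⟨b, b'⟩ := J
  obtain ⟨h1, h2⟩ := hz
  obtain ⟨h3, h4⟩ := hw
  unfold mul
  split
  · rename_i m n e1 e2
    simp only at e1 e2 h1 h2 h3 h4 ⊢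
    have p1 : (0 : ℝ) ≤ a := by
      rw [e1]; exact Int.cast_nonneg (Int.natCast_nonneg m)
    have p2 : (0 : ℝ) ≤ b := by
      rw [e2]; exact Int.cast_nonneg (Int.natCast_nonneg n)
    rw [← e1, ← e2]
    apply mul_mem_of_bounds hP <;> push_cast
    · exact mul_le_mul h1 h3 p2 (p1.trans h1)
    · exact mul_le_mul h2 h4 (p2.trans h3) ((p1.trans h1).trans h2)
  · simp only [imin_eq, imax_eq]
    have := mul_bounds h1 h2 h3 h4
    apply mul_mem_of_bounds hP <;> push_cast
    · exact this.1
    · exact this.2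

end IntervalZ

/-- The ring operations of `ℝ`. -/
def RingOps.real : RingOps ℝ := ⟨fun n => n, (· + ·), (· - ·), (· * ·)⟩

/-- Pointwise operations on real functions. -/
def RingOps.realFun : RingOps (ℝ → ℝ) :=
  ⟨fun n _ => n, fun f g s => f s + g s, fun f g s => f s - g s, fun f g s => f s * g s⟩

theorem IntervalZ.rel {P : ℤ} (hP : 0 < P) : RingOps.real.Rel (ops P) (Mem P) where
  cst n := by simp [RingOps.real, ops, Mem]
  add h h' := by
    obtain ⟨h1, h2⟩ := h
    obtain ⟨h3, h4⟩ := h'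
    constructor <;> simp only [RingOps.real, ops] <;> push_cast <;> linarith
  sub h h' := by
    obtain ⟨h1, h2⟩ := h
    obtain ⟨h3, h4⟩ := h'
    constructor <;> simp only [RingOps.real, ops] <;> push_cast <;> linarith
  mul h h' := mul_mem hP h h'

/-! ### Interval forward differentiation -/

/-- An interval for a value and intervals for two partial derivatives. -/
structure DualZ where
  v : IntervalZ
  a : IntervalZ
  b : IntervalZ

namespace DualZ

/-- Forward differentiation over fixed-point intervals. -/
def ops (P : ℤ) : RingOps DualZ :=
  let O := IntervalZ.ops P
  { cst := fun n => ⟨O.cst n, O.cst 0, O.cst 0⟩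
    add := fun X Y => ⟨O.add X.v Y.v, O.add X.a Y.a, O.add X.b Y.b⟩
    sub := fun X Y => ⟨O.sub X.v Y.v, O.sub X.a Y.a, O.sub X.b Y.b⟩
    mul := fun X Y => ⟨O.mul X.v Y.v, O.add (O.mul X.v Y.a) (O.mul X.a Y.v),
      O.add (O.mul X.v Y.b) (O.mul X.b Y.v)⟩ }

/-- The value of `F` at `s` is in the first interval, and the derivative is `a ξ + b η` with `a`
and `b` in the other two. -/
def Mem (P : ℤ) (ξ η s : ℝ) (F : ℝ → ℝ) (X : DualZ) : Prop :=
  IntervalZ.Mem P (F s) X.v ∧ ∃ a b : ℝ, IntervalZ.Mem P a X.a ∧ IntervalZ.Mem P b X.b ∧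
    HasDerivAt F (a * ξ + b * η) s

theorem rel {P : ℤ} (hP : 0 < P) (ξ η s : ℝ) : RingOps.realFun.Rel (ops P) (Mem P ξ η s) where
  cst n := by
    have e : RingOps.real.cst 0 = 0 := Int.cast_zero
    refine ⟨(IntervalZ.rel hP).cst n, 0, 0, ?_, ?_, ?_⟩
    · exact e ▸ (IntervalZ.rel hP).cst 0
    · exact e ▸ (IntervalZ.rel hP).cst 0
    · simpa [RingOps.realFun] using hasDerivAt_const s (n : ℝ)
  add h h' := by
    obtain ⟨h1, a, b, ha, hb, hd⟩ := h
    obtain ⟨h1', a', b', ha', hb', hd'⟩ := h'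
    refine ⟨(IntervalZ.rel hP).add h1 h1', a + a', b + b', (IntervalZ.rel hP).add ha ha',
      (IntervalZ.rel hP).add hb hb', ?_⟩
    exact (hd.fun_add hd').congr_deriv (by ring)
  sub h h' := by
    obtain ⟨h1, a, b, ha, hb, hd⟩ := h
    obtain ⟨h1', a', b', ha', hb', hd'⟩ := h'
    refine ⟨(IntervalZ.rel hP).sub h1 h1', a - a', b - b', (IntervalZ.rel hP).sub ha ha',
      (IntervalZ.rel hP).sub hb hb', ?_⟩
    exact (hd.fun_sub hd').congr_deriv (by ring)
  mul {F F' G G'} h h' := by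
    obtain ⟨h1, a, b, ha, hb, hd⟩ := h
    obtain ⟨h1', a', b', ha', hb', hd'⟩ := h'
    have r := IntervalZ.rel hP
    refine ⟨r.mul h1 h1', F s * a' + a * G s, F s * b' + b * G s,
      r.add (r.mul h1 ha') (r.mul ha h1'), r.add (r.mul h1 hb') (r.mul hb h1'), ?_⟩
    exact (hd.fun_mul hd').congr_deriv (by ring)

end DualZ

/-! ### The kite quantities as one formula over any carrier -/

/-- Quantities derived from `x = s(a)`, `c = 1 / a`, `y = s(b)`, `g = 1 / b`. -/
structure KiteData (R : Type*) where
  d : R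
  k : R
  q : R
  k' : R
  q' : R
  e : R
  f : R
  n₁ : R
  n₂ : R
  al : R
  be : R
  phi : R
  s : R
  u₁ : R
  u₂ : R
  tr : R

/-- On solutions, `h₁ = k d² / (4 e)` and `h₂ = q d² / (4 f)` agree, that is `phi = 0`, and the
Jacobian determinant is `s` up to a nonzero factor. -/
def RingOps.kite {R : Type*} (O : RingOps R) (x c y g : R) : KiteData R :=
  let d := O.sub y x
  let one := O.cst 1
  let two := O.cst 2
  let three := O.cst 3
  let A₈ := O.mul (O.cst 8) (O.mul c (O.mul c c))
  let B₈ := O.mul (O.cst 8) (O.mul g (O.mul g g))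
  let k := O.mul x (O.sub A₈ one)
  let q := O.mul y (O.sub one B₈)
  let xc := O.mul x c
  let yg := O.mul y g
  -- `k'` and `q'` are dk/dx and dq/dy, by dc/dx = -x c³ and dg/dy = -y g³.
  let k' := O.sub (O.mul A₈ (O.sub one (O.mul three (O.mul xc xc)))) one
  let q' := O.sub one (O.mul B₈ (O.sub one (O.mul three (O.mul yg yg))))
  let dc := O.mul d c
  let dg := O.mul d g
  let dA := O.mul dc (O.mul dc dc)
  let dB := O.mul dg (O.mul dg dg)
  let e := O.sub one dB
  let f := O.sub one dA
  let p₁ := O.mul three (O.mul dB (O.mul yg g))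
  let p₂ := O.mul three (O.mul dA (O.mul xc c))
  let n₁ := O.sub (O.add two dB) (O.mul d p₁)
  let n₂ := O.add (O.add two dA) (O.mul d p₂)
  let al := O.sub (O.mul k p₁) (O.mul k' e)
  let be := O.sub (O.mul q' e) (O.mul k p₂)
  let phi := O.sub (O.mul k f) (O.mul q e)
  -- Since u₁ = k n₁ + d al and u₂ = k n₂ + d be, this is (u₁ u₂ - k² n₁ n₂)/d with the factor d
  -- cancelled beforehand.
  let s := O.add (O.mul k (O.add (O.mul n₁ be) (O.mul n₂ al))) (O.mul d (O.mul al be))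
  let u₁ := O.sub (O.mul k (O.add two dB)) (O.mul k' (O.mul d e))
  let u₂ := O.add (O.mul k (O.add two dA)) (O.mul q' (O.mul d e))
  let tr := O.sub (O.mul xc (O.mul e u₂)) (O.mul yg (O.mul f u₁))
  ⟨d, k, q, k', q', e, f, n₁, n₂, al, be, phi, s, u₁, u₂, tr⟩

/-- Componentwise `ρ`, for the components on which numerical information is needed. -/
structure KiteData.Rel {R R' : Type*} (ρ : R → R' → Prop) (D : KiteData R) (D' : KiteData R') :
    Prop where
  d : ρ D.d D'.d
  k : ρ D.k D'.k
  e : ρ D.e D'.e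
  f : ρ D.f D'.f
  al : ρ D.al D'.al
  be : ρ D.be D'.be
  phi : ρ D.phi D'.phi
  s : ρ D.s D'.s
  tr : ρ D.tr D'.tr

/-- Parametricity: the formula uses only the ring operations, so any relation they respect passes
from the inputs to all outputs. Interval enclosures and derivative enclosures are both instances. -/
theorem RingOps.Rel.kite {R R' : Type*} {O : RingOps R} {O' : RingOps R'} {ρ : R → R' → Prop}
    (r : O.Rel O' ρ) {x c y g : R} {x' c' y' g' : R'} (hx : ρ x x') (hc : ρ c c')
    (hy : ρ y y') (hg : ρ g g') : (O.kite x c y g).Rel ρ (O'.kite x' c' y' g') := by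
  have hd := r.sub hy hx
  have hA := r.mul (r.cst 8) (r.mul hc (r.mul hc hc))
  have hB := r.mul (r.cst 8) (r.mul hg (r.mul hg hg))
  have hk := r.mul hx (r.sub hA (r.cst 1))
  have hq := r.mul hy (r.sub (r.cst 1) hB)
  have hxc := r.mul hx hc
  have hyg := r.mul hy hg
  have hk' := r.sub (r.mul hA (r.sub (r.cst 1) (r.mul (r.cst 3) (r.mul hxc hxc)))) (r.cst 1)
  have hq' := r.sub (r.cst 1) (r.mul hB (r.sub (r.cst 1) (r.mul (r.cst 3) (r.mul hyg hyg))))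
  have hdc := r.mul hd hc
  have hdg := r.mul hd hg
  have hdA := r.mul hdc (r.mul hdc hdc)
  have hdB := r.mul hdg (r.mul hdg hdg)
  have he := r.sub (r.cst 1) hdB
  have hf := r.sub (r.cst 1) hdA
  have hp₁ := r.mul (r.cst 3) (r.mul hdB (r.mul hyg hg))
  have hp₂ := r.mul (r.cst 3) (r.mul hdA (r.mul hxc hc))
  have hn₁ := r.sub (r.add (r.cst 2) hdB) (r.mul hd hp₁)
  have hn₂ := r.add (r.add (r.cst 2) hdA) (r.mul hd hp₂)
  have hal := r.sub (r.mul hk hp₁) (r.mul hk' he)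
  have hbe := r.sub (r.mul hq' he) (r.mul hk hp₂)
  have hphi := r.sub (r.mul hk hf) (r.mul hq he)
  have hs := r.add (r.mul hk (r.add (r.mul hn₁ hbe) (r.mul hn₂ hal)))
    (r.mul hd (r.mul hal hbe))
  have hu₁ := r.sub (r.mul hk (r.add (r.cst 2) hdB)) (r.mul hk' (r.mul hd he))
  have hu₂ := r.add (r.mul hk (r.add (r.cst 2) hdA)) (r.mul hq' (r.mul hd he))
  have htr := r.sub (r.mul hxc (r.mul he hu₂)) (r.mul hyg (r.mul hf hu₁))
  exact ⟨hd, hk, he, hf, hal, hbe, hphi, hs, htr⟩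

/-- The kite quantities of the real heights `x`, `y`. -/
noncomputable def kiteAt (x y : ℝ) : KiteData ℝ :=
  RingOps.real.kite x (1 / √(1 + x ^ 2)) y (1 / √(1 + y ^ 2))

/-! ### Enclosures over boxes and bisection -/

namespace IntervalZ

/-- The interval contains only positive numbers. -/
def pos (I : IntervalZ) : Bool := decide (0 < I.lo)

/-- The interval contains only negative numbers. -/
def neg (I : IntervalZ) : Bool := decide (I.hi < 0)

/-- Range of `(1 / t - t) / 2` for `t` in `I`. -/
def heightRange (P : ℤ) (I : IntervalZ) : IntervalZ :=
  ⟨(P * P - I.hi * I.hi) / (2 * I.hi), -(-(P * P - I.lo * I.lo) / (2 * I.lo))⟩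

/-- Range of `2 t / (1 + t²)` for `t` in `I`. -/
def cosRange (P : ℤ) (I : IntervalZ) : IntervalZ :=
  ⟨2 * I.lo * (P * P) / (P * P + I.lo * I.lo), -(-(2 * I.hi * (P * P)) / (P * P + I.hi * I.hi))⟩

/-- Interval enclosure of the kite quantities over a box. -/
def kite (P : ℤ) (I J : IntervalZ) : KiteData IntervalZ :=
  (ops P).kite (heightRange P I) (cosRange P I) (heightRange P J) (cosRange P J)

/-- Verify a test on a box by bisection, to depth at most the third argument. -/
def cover (ok : IntervalZ → IntervalZ → Bool) : ℕ → IntervalZ → IntervalZ → Bool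
  | 0, _, _ => false
  | n + 1, I, J =>
    ok I J ||
      bif decide (I.hi - I.lo ≤ 2 * (J.hi - J.lo)) then
        cover ok n I ⟨J.lo, (J.lo + J.hi) / 2⟩ && cover ok n I ⟨(J.lo + J.hi) / 2, J.hi⟩
      else
        cover ok n ⟨I.lo, (I.lo + I.hi) / 2⟩ J && cover ok n ⟨(I.lo + I.hi) / 2, I.hi⟩ J

theorem pos_sound {P : ℤ} (hP : 0 < P) {z : ℝ} {I : IntervalZ} (h : I.pos = true)
    (hz : Mem P z I) : 0 < z := by
  have h1 : (0 : ℝ) < I.lo := by exact_mod_cast of_decide_eq_true h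
  exact pos_of_mul_pos_left (h1.trans_le hz.1) (by exact_mod_cast hP.le)

theorem neg_sound {P : ℤ} (hP : 0 < P) {z : ℝ} {I : IntervalZ} (h : I.neg = true)
    (hz : Mem P z I) : z < 0 := by
  have h1 : (I.hi : ℝ) < 0 := by exact_mod_cast of_decide_eq_true h
  exact neg_of_mul_neg_left (hz.2.trans_lt h1) (by exact_mod_cast hP.le)

theorem Mem.split {P : ℤ} {z : ℝ} {I : IntervalZ} (hz : Mem P z I) (m : ℤ) :
    Mem P z ⟨I.lo, m⟩ ∨ Mem P z ⟨m, I.hi⟩ :=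
  (le_total (z * P) m).imp (fun h => ⟨hz.1, h⟩) fun h => ⟨h, hz.2⟩

/-- A box that passes `cover` can be refined around each of its points to a box that passes the
test, without leaving the original ranges. -/
theorem cover_sound {P : ℤ} {ok : IntervalZ → IntervalZ → Bool} {t u : ℝ} :
    ∀ (n : ℕ) {I J : IntervalZ}, 0 < I.lo → I.hi ≤ P → 0 < J.lo → J.hi ≤ P →
      cover ok n I J = true → Mem P t I → Mem P u J →
      ∃ I' J', ok I' J' = true ∧ Mem P t I' ∧ Mem P u J' ∧
        0 < I'.lo ∧ I'.hi ≤ P ∧ 0 < J'.lo ∧ J'.hi ≤ P := by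
  intro n
  induction n with
  | zero => intro I J _ _ _ _ h; simp [cover] at h
  | succ n ih =>
    intro I J h1 h2 h3 h4 h ht hu
    rw [cover, Bool.or_eq_true] at h
    have hI : I.lo ≤ I.hi := by exact_mod_cast ht.1.trans ht.2
    have hJ : J.lo ≤ J.hi := by exact_mod_cast hu.1.trans hu.2
    rcases h with h | h
    · exact ⟨I, J, h, ht, hu, h1, h2, h3, h4⟩
    · cases hb : decide (I.hi - I.lo ≤ 2 * (J.hi - J.lo)) <;> rw [hb] at h <;>
        simp only [cond_true, cond_false, Bool.and_eq_true] at h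
      · rcases ht.split ((I.lo + I.hi) / 2) with ht | ht
        · exact ih (I := ⟨I.lo, (I.lo + I.hi) / 2⟩) h1 (by simp only; omega) h3 h4 h.1 ht hu
        · exact ih (I := ⟨(I.lo + I.hi) / 2, I.hi⟩) (by simp only; omega) h2 h3 h4 h.2 ht hu
      · rcases hu.split ((J.lo + J.hi) / 2) with hu | hu
        · exact ih (J := ⟨J.lo, (J.lo + J.hi) / 2⟩) h1 h2 h3 (by simp only; omega) h.1 ht hu
        · exact ih (J := ⟨(J.lo + J.hi) / 2, J.hi⟩) h1 h2 (by simp only; omega) h4 h.2 ht hu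

/-- The positive real `t` with `x = (1 / t - t) / 2`. -/
noncomputable def param (x : ℝ) : ℝ := √(1 + x ^ 2) - x

theorem heightRange_mem {P : ℤ} (hP : 0 < P) {x : ℝ} {I : IntervalZ} (h0 : 0 < I.lo)
    (hx : Mem P (param x) I) : Mem P x (heightRange P I) := by
  set t := param x with ht
  have hP' : (0 : ℝ) < P := by exact_mod_cast hP
  have h0' : (0 : ℝ) < I.lo := by exact_mod_cast h0
  obtain ⟨h1, h2⟩ := hx
  have hT : 0 < t * P := h0'.trans_le h1
  have ht0 : 0 < t := pos_of_mul_pos_left hT hP'.le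
  have hh : (0 : ℝ) < I.hi := hT.trans_le h2
  have hxt : 2 * x * t = 1 - t ^ 2 := by
    have hs : √(1 + x ^ 2) ^ 2 = 1 + x ^ 2 := Real.sq_sqrt (by positivity)
    rw [ht, param]; linear_combination hs
  have hX : x * P = ((P : ℝ) * P - (t * P) * (t * P)) / (2 * (t * P)) := by
    rw [eq_div_iff (by positivity)]
    linear_combination (P : ℝ) ^ 2 * hxt
  -- (1/t - t)/2 decreases in t, so the two endpoints change places.
  have mono : ∀ {v w : ℝ}, 0 < v → v ≤ w →
      ((P : ℝ) * P - w * w) / (2 * w) ≤ ((P : ℝ) * P - v * v) / (2 * v) := by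
    intro v w hv hvw
    have hw := hv.trans_le hvw
    rw [div_le_div_iff₀ (by positivity) (by positivity)]
    have : 0 ≤ (w - v) * ((P : ℝ) * P + v * w) :=
      mul_nonneg (by linarith) (by positivity)
    linarith
  have hhZ : 0 < 2 * I.hi := by have : 0 < I.hi := by exact_mod_cast hh
                                omega
  constructor
  · refine (ediv_cast_le hhZ _).trans ?_
    rw [hX]
    push_cast
    exact mono hT h2
  · refine le_trans ?_ (le_neg_ediv_cast (by omega) _)
    rw [hX]
    push_cast
    exact mono h0' h1

theorem cosRange_mem {P : ℤ} (hP : 0 < P) {x : ℝ} {I : IntervalZ} (h0 : 0 < I.lo)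
    (h1P : I.hi ≤ P) (hx : Mem P (param x) I) : Mem P (1 / √(1 + x ^ 2)) (cosRange P I) := by
  set t := param x with ht
  have hP' : (0 : ℝ) < P := by exact_mod_cast hP
  have h0' : (0 : ℝ) < I.lo := by exact_mod_cast h0
  have h1P' : (I.hi : ℝ) ≤ P := by exact_mod_cast h1P
  obtain ⟨h1, h2⟩ := hx
  have hT : 0 < t * P := h0'.trans_le h1
  have ht0 : 0 < t := pos_of_mul_pos_left hT hP'.le
  have hh : (0 : ℝ) < I.hi := hT.trans_le h2
  have ha : 0 < √(1 + x ^ 2) := Real.sqrt_pos.2 (by positivity)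
  have hat : 2 * √(1 + x ^ 2) * t = 1 + t ^ 2 := by
    have hs : √(1 + x ^ 2) ^ 2 = 1 + x ^ 2 := Real.sq_sqrt (by positivity)
    rw [ht, param]; linear_combination hs
  have hX : 1 / √(1 + x ^ 2) * P =
      2 * (t * P) * ((P : ℝ) * P) / ((P : ℝ) * P + (t * P) * (t * P)) := by
    rw [eq_div_iff (by positivity), one_div, mul_assoc, inv_mul_eq_iff_eq_mul₀ ha.ne']
    linear_combination (-(P : ℝ) ^ 3) * hat
  -- 2t/(1 + t²) increases only up to t = 1; this is where `I.hi ≤ P` is needed.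
  have mono : ∀ {v w : ℝ}, 0 < v → v ≤ w → w ≤ P →
      2 * v * ((P : ℝ) * P) / ((P : ℝ) * P + v * v) ≤
        2 * w * ((P : ℝ) * P) / ((P : ℝ) * P + w * w) := by
    intro v w hv hvw hwP
    have hw := hv.trans_le hvw
    rw [div_le_div_iff₀ (by positivity) (by positivity)]
    have h3 : v * w ≤ (P : ℝ) * P := mul_le_mul (hvw.trans hwP) hwP hw.le hP'.le
    have : 0 ≤ 2 * ((P : ℝ) * P) * ((w - v) * ((P : ℝ) * P - v * w)) :=
      mul_nonneg (by positivity) (mul_nonneg (by linarith) (by linarith))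
    linarith
  have q1 : 0 < P * P + I.lo * I.lo := by positivity
  have q2 : 0 < P * P + I.hi * I.hi := add_pos_of_pos_of_nonneg (mul_pos hP hP) (mul_self_nonneg _)
  constructor
  · refine (ediv_cast_le q1 _).trans ?_
    rw [hX]
    push_cast
    exact mono h0' h1 (h2.trans h1P')
  · refine le_trans ?_ (le_neg_ediv_cast q2 _)
    rw [hX]
    push_cast
    exact mono hT h2 h1P'

theorem kite_mem {P : ℤ} (hP : 0 < P) {x y : ℝ} {I J : IntervalZ} (hI : 0 < I.lo)
    (hI' : I.hi ≤ P) (hJ : 0 < J.lo) (hJ' : J.hi ≤ P) (hx : Mem P (param x) I)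
    (hy : Mem P (param y) J) : (kiteAt x y).Rel (Mem P) (kite P I J) :=
  (rel hP).kite (heightRange_mem hP hI hx) (cosRange_mem hP hI hI' hx) (heightRange_mem hP hJ hy)
    (cosRange_mem hP hJ hJ' hy)

end IntervalZ

namespace DualZ

/-- Enclosure of the kite quantities and of their derivatives in `x` and `y` over a box. -/
def kite (P : ℤ) (I J : IntervalZ) : KiteData DualZ :=
  let O := IntervalZ.ops P
  let x := IntervalZ.heightRange P I
  let c := IntervalZ.cosRange P I
  let y := IntervalZ.heightRange P J
  let g := IntervalZ.cosRange P J
  let z := O.cst 0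
  (ops P).kite ⟨x, O.cst 1, z⟩ ⟨c, O.sub z (O.mul x (O.mul c (O.mul c c))), z⟩
    ⟨y, z, O.cst 1⟩ ⟨g, z, O.sub z (O.mul y (O.mul g (O.mul g g)))⟩

/-- This is dc/dx = -x c³ for c = 1/√(1 + x²), written as the seed for the dual numbers expects it.
-/
theorem _root_.hasDerivAt_one_div_sqrt_one_add_sq {F : ℝ → ℝ} {ξ s : ℝ} (h : HasDerivAt F ξ s) :
    HasDerivAt (fun r => 1 / √(1 + F r ^ 2))
      ((0 - F s * (1 / √(1 + F s ^ 2) * (1 / √(1 + F s ^ 2) * (1 / √(1 + F s ^ 2))))) * ξ) s := by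
  have hp : 0 < 1 + F s ^ 2 := by positivity
  have h1 : HasDerivAt (fun r => 1 + F r ^ 2) (2 * F s * ξ) s := by
    simpa using (h.fun_pow 2).const_add 1
  have h2 := (h1.sqrt hp.ne').fun_inv (Real.sqrt_pos.2 hp).ne'
  simp only [one_div]
  refine h2.congr_deriv ?_
  have := (Real.sqrt_pos.2 hp).ne'
  field_simp
  ring

/-- Enclosure of the kite quantities along a curve through the box. -/
theorem kite_mem {P : ℤ} (hP : 0 < P) {X Y : ℝ → ℝ} {ξ η s : ℝ} {I J : IntervalZ} (hI : 0 < I.lo)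
    (hI' : I.hi ≤ P) (hJ : 0 < J.lo) (hJ' : J.hi ≤ P)
    (hx : IntervalZ.Mem P (IntervalZ.param (X s)) I)
    (hy : IntervalZ.Mem P (IntervalZ.param (Y s)) J)
    (hX : HasDerivAt X ξ s) (hY : HasDerivAt Y η s) :
    (RingOps.realFun.kite X (fun r => 1 / √(1 + X r ^ 2)) Y (fun r => 1 / √(1 + Y r ^ 2))).Rel
      (Mem P ξ η s) (kite P I J) := by
  have r := IntervalZ.rel hP
  have m0 := r.cst 0
  have m1 := r.cst 1
  have hx' := IntervalZ.heightRange_mem hP hI hx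
  have hc' := IntervalZ.cosRange_mem hP hI hI' hx
  have hy' := IntervalZ.heightRange_mem hP hJ hy
  have hg' := IntervalZ.cosRange_mem hP hJ hJ' hy
  apply (rel hP ξ η s).kite
  · exact ⟨hx', _, _, m1, m0, hX.congr_deriv (by simp [RingOps.real])⟩
  · exact ⟨hc', _, _, r.sub m0 (r.mul hx' (r.mul hc' (r.mul hc' hc'))), m0,
      (hasDerivAt_one_div_sqrt_one_add_sq hX).congr_deriv (by simp [RingOps.real])⟩
  · exact ⟨hy', _, _, m0, m1, hY.congr_deriv (by simp [RingOps.real])⟩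
  · exact ⟨hg', _, _, m0, r.sub m0 (r.mul hy' (r.mul hg' (r.mul hg' hg'))),
      (hasDerivAt_one_div_sqrt_one_add_sq hY).congr_deriv (by simp [RingOps.real])⟩

end DualZ

/-! ### Sign conditions verified by computation -/

namespace ConcaveKite
open IntervalZ

/-- The parameter box around the fold. -/
def foldBox : IntervalZ × IntervalZ := (⟨142 * 2 ^ 12, 144 * 2 ^ 12⟩, ⟨268 * 2 ^ 10, 270 * 2 ^ 10⟩)

/-- The system has no degenerate solution in the box, or the box is part of `foldBox`. -/
def regularOrFold (I J : IntervalZ) : Bool :=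
  let D := IntervalZ.kite (2 ^ 20) I J
  D.phi.pos || D.phi.neg || D.s.pos || D.s.neg || (D.al.pos && D.be.pos) ||
    (decide (foldBox.1.lo ≤ I.lo) && decide (I.hi ≤ foldBox.1.hi) &&
      (decide (foldBox.2.lo ≤ J.lo) && decide (J.hi ≤ foldBox.2.hi)))

-- In units of 2⁻²⁰ the parameters range over [1/4, 1] and [1/8, 1/2], that is 0 ≤ x ≤ 15/8 and 3/4
-- ≤ y ≤ 63/16, the region given by `solution_bounds`.
set_option maxRecDepth 100000 in
theorem cover_regularOrFold :
    cover regularOrFold 30 ⟨2 ^ 18, 2 ^ 20⟩ ⟨2 ^ 17, 2 ^ 19⟩ = true := by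
  decide +kernel

/-- On the box, `phi` decreases in `y` and the Jacobian determinant of `(phi, s)` is positive. -/
def transversal (P : ℤ) (I J : IntervalZ) : Bool :=
  let D := DualZ.kite P I J
  let O := IntervalZ.ops P
  D.phi.b.neg && (O.sub (O.mul D.phi.a D.s.b) (O.mul D.phi.b D.s.a)).pos

/-- The enclosures bound the entries of the Jacobian of (phi, s) independently, so the determinant
stays positive even when its rows are taken at different points of the box. -/
theorem transversal_foldBox : transversal (2 ^ 20) foldBox.1 foldBox.2 = true := by
  decide +kernel

/-- A small box around the fold, in units of `2⁻⁴⁵`. -/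
def smallBox : IntervalZ × IntervalZ :=
  (⟨19686449517019, 19686453711323⟩, ⟨9230824785430, 9230826882582⟩)

/-- Signs on a box, and the enclosure of the mass `k d² / (4 e)`. -/
def nearFold (I J : IntervalZ) : Bool :=
  let P := 2 ^ 45
  let D := IntervalZ.kite P I J
  let O := IntervalZ.ops P
  let n := O.mul (O.cst 1000000) (O.mul D.k (O.mul D.d D.d))
  D.d.pos && D.k.pos && D.e.pos && D.f.pos && D.tr.pos &&
    (O.sub n (O.mul (O.cst (4 * 1002705)) D.e)).pos &&
    (O.sub n (O.mul (O.cst (4 * 1002715)) D.e)).neg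

/-- The small box is narrower than one unit 2⁻²⁰, hence the finer unit. The constants 1002705 and
1002715 are 10⁶ (1.00271 ∓ 5·10⁻⁶), compared with 10⁶ k d²/(4e) after clearing the denominator. -/
theorem cover_nearFold : cover nearFold 20 smallBox.1 smallBox.2 = true := by decide +kernel

/-- The height decreases in the parameter: the upper parameter end is the edge of smallest y. With
the next lemma, `phi` changes sign from positive to negative as y crosses the box. -/
theorem cover_smallBox_phi_pos :
    cover (fun I J => (IntervalZ.kite (2 ^ 45) I J).phi.pos) 20 smallBox.1
      ⟨smallBox.2.hi, smallBox.2.hi⟩ = true := by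
  decide +kernel

theorem cover_smallBox_phi_neg :
    cover (fun I J => (IntervalZ.kite (2 ^ 45) I J).phi.neg) 20 smallBox.1
      ⟨smallBox.2.lo, smallBox.2.lo⟩ = true := by
  decide +kernel

/-- The sign of `s` matters only where the curve `phi` = 0 meets the edge, so subboxes on which
`phi` has a sign may be discarded. The upper parameter end is the edge of smallest x. -/
theorem cover_smallBox_s_neg :
    cover (fun I J =>
      let D := IntervalZ.kite (2 ^ 45) I J
      D.phi.pos || D.phi.neg || D.s.neg) 20 ⟨smallBox.1.hi, smallBox.1.hi⟩ smallBox.2 = true := by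
  decide +kernel

theorem cover_smallBox_s_pos :
    cover (fun I J =>
      let D := IntervalZ.kite (2 ^ 45) I J
      D.phi.pos || D.phi.neg || D.s.pos) 20 ⟨smallBox.1.lo, smallBox.1.lo⟩ smallBox.2 = true := by
  decide +kernel

end ConcaveKite

/-! ### Continuous zero curves and the parametrization of heights -/

open Set Filter in
/-- A continuous function of two variables, strictly decreasing in the second, has a continuous
curve of zeros over an interval at whose points it changes sign in the second variable. -/
theorem exists_continuousOn_zero {f : ℝ → ℝ → ℝ} (hf : Continuous fun p : ℝ × ℝ => f p.1 p.2)
    {S : Set ℝ} {l r : ℝ} (hlr : l ≤ r) (hanti : ∀ x ∈ S, StrictAntiOn (f x) (Icc l r))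
    (hl : ∀ x ∈ S, 0 < f x l) (hr : ∀ x ∈ S, f x r < 0) :
    ∃ Y : ℝ → ℝ, ContinuousOn Y S ∧ ∀ x ∈ S, Y x ∈ Icc l r ∧ f x (Y x) = 0 := by
  have hx : ∀ x y : ℝ, Continuous (f x) ∧ Continuous fun z => f z y := fun x y =>
    ⟨hf.comp (by fun_prop : Continuous fun y : ℝ => (x, y)),
      hf.comp (by fun_prop : Continuous fun z : ℝ => (z, y))⟩
  have ex : ∀ x : ℝ, ∃ y, x ∈ S → y ∈ Icc l r ∧ f x y = 0 := fun x => by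
    by_cases h : x ∈ S
    · obtain ⟨y, hy, h0⟩ := intermediate_value_Icc' hlr (hx x 0).1.continuousOn
        (show (0 : ℝ) ∈ Icc _ _ from ⟨(hr x h).le, (hl x h).le⟩)
      exact ⟨y, fun _ => ⟨hy, h0⟩⟩
    · exact ⟨0, fun h' => (h h').elim⟩
  choose Y hY using ex
  refine ⟨Y, fun x h => ?_, hY⟩
  obtain ⟨⟨h1, h2⟩, h3⟩ := hY x h
  rw [ContinuousWithinAt, tendsto_order]
  constructor
  · intro u hu
    by_cases hul : u < l
    · filter_upwards [self_mem_nhdsWithin] with z hz using hul.trans_le (hY z hz).1.1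
    · rw [not_lt] at hul
      have hu' : u ∈ Icc l r := ⟨hul, hu.le.trans h2⟩
      -- Positivity at height u persists for nearby abscissas, and monotonicity then keeps their
      -- zeros above u.
      have pos : 0 < f x u := h3 ▸ hanti x h hu' ⟨h1, h2⟩ hu
      filter_upwards [self_mem_nhdsWithin,
        mem_nhdsWithin_of_mem_nhds ((hx 0 u).2.continuousAt.eventually (lt_mem_nhds pos))]
        with z hz hzu
      by_contra hc
      have := (hanti z hz).antitoneOn (hY z hz).1 hu' (not_lt.1 hc)
      rw [(hY z hz).2] at this
      exact this.not_gt hzu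
  · intro u hu
    by_cases hur : r < u
    · filter_upwards [self_mem_nhdsWithin] with z hz using (hY z hz).1.2.trans_lt hur
    · rw [not_lt] at hur
      have hu' : u ∈ Icc l r := ⟨h1.trans hu.le, hur⟩
      have neg : f x u < 0 := h3 ▸ hanti x h ⟨h1, h2⟩ hu' hu
      filter_upwards [self_mem_nhdsWithin,
        mem_nhdsWithin_of_mem_nhds ((hx 0 u).2.continuousAt.eventually (gt_mem_nhds neg))]
        with z hz hzu
      by_contra hc
      have := (hanti z hz).antitoneOn hu' (hY z hz).1 (not_lt.1 hc)
      rw [(hY z hz).2] at this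
      exact this.not_gt hzu

namespace IntervalZ

theorem param_pos (x : ℝ) : 0 < param x := by
  have : √(x ^ 2) < √(1 + x ^ 2) := Real.sqrt_lt_sqrt (by positivity) (by linarith)
  rw [Real.sqrt_sq_eq_abs] at this
  have := le_abs_self x
  rw [param]
  linarith

theorem param_sq (x : ℝ) : param x ^ 2 + 2 * x * param x = 1 := by
  have hs : √(1 + x ^ 2) ^ 2 = 1 + x ^ 2 := Real.sq_sqrt (by positivity)
  rw [param]
  linear_combination hs

theorem param_eq_aux (x t : ℝ) :
    (x * 2 + t) * t = 1 + (t - param x) * (t + (param x + 2 * x)) ∧ 0 < param x + 2 * x := by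
  have h1 := param_sq x
  have h2 := param_pos x
  exact ⟨by linear_combination h1, pos_of_mul_pos_right (a := param x) (by linarith) h2.le⟩

theorem param_le_iff {x t : ℝ} (ht : 0 < t) : param x ≤ t ↔ (1 / t - t) / 2 ≤ x := by
  obtain ⟨h1, h2⟩ := param_eq_aux x t
  rw [div_le_iff₀ two_pos, sub_le_iff_le_add, div_le_iff₀ ht, h1, le_add_iff_nonneg_right,
    mul_nonneg_iff_of_pos_right (by linarith), sub_nonneg]

theorem le_param_iff {x t : ℝ} (ht : 0 < t) : t ≤ param x ↔ x ≤ (1 / t - t) / 2 := by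
  obtain ⟨h1, h2⟩ := param_eq_aux x t
  have h3 : (t - param x) * (t + (param x + 2 * x)) ≤ 0 ↔ t - param x ≤ 0 := by
    rw [← not_lt, mul_pos_iff_of_pos_right (by linarith), not_lt]
  rw [le_div_iff₀ two_pos, le_sub_iff_add_le, le_div_iff₀ ht, h1, add_le_iff_nonpos_right, h3,
    sub_nonpos]

/-- The height range of a parameter interval. -/
theorem mem_param_iff {P : ℤ} (hP : 0 < P) {x : ℝ} {I : IntervalZ} (h0 : 0 < I.lo)
    (h1 : 0 < I.hi) :
    Mem P (param x) I ↔ x ∈ Set.Icc ((1 / (I.hi / P : ℝ) - I.hi / P) / 2)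
      ((1 / (I.lo / P : ℝ) - I.lo / P) / 2) := by
  have hP' : (0 : ℝ) < P := by exact_mod_cast hP
  have h0' : (0 : ℝ) < I.lo := by exact_mod_cast h0
  have h1' : (0 : ℝ) < I.hi := by exact_mod_cast h1
  rw [Set.mem_Icc, ← param_le_iff (by positivity), ← le_param_iff (by positivity), Mem,
    div_le_iff₀ hP', le_div_iff₀ hP', and_comm]

end IntervalZ

open IntervalZ

theorem continuous_kite :
    (Continuous fun p : ℝ × ℝ => (kiteAt p.1 p.2).phi) ∧
      Continuous fun p : ℝ × ℝ => (kiteAt p.1 p.2).s := by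
  have hc : Continuous fun x : ℝ => 1 / √(1 + x ^ 2) :=
    continuous_const.div (by fun_prop) fun x => (Real.sqrt_pos.2 (by positivity)).ne'
  have h1 : Continuous fun p : ℝ × ℝ => 1 / √(1 + p.1 ^ 2) := hc.comp continuous_fst
  have h2 : Continuous fun p : ℝ × ℝ => 1 / √(1 + p.2 ^ 2) := hc.comp continuous_snd
  constructor <;> simp only [kiteAt, RingOps.kite, RingOps.real] <;> fun_prop

/-- Along a curve through a transversal box, `phi` and `s` have derivatives that are combinations
of the velocities with coefficients in the enclosures. -/
theorem hasDerivAt_kite {P : ℤ} (hP : 0 < P) {X Y : ℝ → ℝ} {ξ η s : ℝ} {I J : IntervalZ}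
    (hI : 0 < I.lo) (hI' : I.hi ≤ P) (hJ : 0 < J.lo) (hJ' : J.hi ≤ P)
    (hx : Mem P (param (X s)) I) (hy : Mem P (param (Y s)) J) (hX : HasDerivAt X ξ s)
    (hY : HasDerivAt Y η s) :
    (∃ a b : ℝ, Mem P a (DualZ.kite P I J).phi.a ∧ Mem P b (DualZ.kite P I J).phi.b ∧
      HasDerivAt (fun r => (kiteAt (X r) (Y r)).phi) (a * ξ + b * η) s) ∧
    ∃ a b : ℝ, Mem P a (DualZ.kite P I J).s.a ∧ Mem P b (DualZ.kite P I J).s.b ∧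
      HasDerivAt (fun r => (kiteAt (X r) (Y r)).s) (a * ξ + b * η) s :=
  have h := DualZ.kite_mem hP hI hI' hJ hJ' hx hy hX hY
  ⟨h.phi.2, h.s.2⟩

/-! ### Uniqueness and existence of the common zero of `phi` and `s` -/

namespace ConcaveKite

theorem transversal_phi_neg {P : ℤ} (hP : 0 < P) {I J : IntervalZ} (h : transversal P I J = true)
    {b : ℝ} (hb : Mem P b (DualZ.kite P I J).phi.b) : b < 0 := by
  simp only [transversal, Bool.and_eq_true] at h
  exact neg_sound hP h.1 hb

theorem transversal_det_pos {P : ℤ} (hP : 0 < P) {I J : IntervalZ} (h : transversal P I J = true)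
    {a b a' b' : ℝ} (ha : Mem P a (DualZ.kite P I J).phi.a)
    (hb : Mem P b (DualZ.kite P I J).phi.b) (ha' : Mem P a' (DualZ.kite P I J).s.a)
    (hb' : Mem P b' (DualZ.kite P I J).s.b) : 0 < a * b' - b * a' := by
  simp only [transversal, Bool.and_eq_true] at h
  have r := IntervalZ.rel hP
  exact pos_sound hP h.2 (r.sub (r.mul ha hb') (r.mul hb ha'))

/-- The point `(x, y)` of heights lies in `foldBox`. -/
def InFoldBox (x y : ℝ) : Prop :=
  Mem (2 ^ 20) (param x) foldBox.1 ∧ Mem (2 ^ 20) (param y) foldBox.2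

/-- Needed for convexity: the box is defined through the parameters, but is also a rectangle in the
heights, hence contains segments in the (x, y)-plane. -/
theorem inFoldBox_iff : ∃ l r l' r' : ℝ, ∀ x y, InFoldBox x y ↔
    x ∈ Set.Icc l r ∧ y ∈ Set.Icc l' r' :=
  ⟨_, _, _, _, fun x y => and_congr
    (mem_param_iff (by norm_num) (by norm_num [foldBox]) (by norm_num [foldBox]))
    (mem_param_iff (by norm_num) (by norm_num [foldBox]) (by norm_num [foldBox]))⟩

theorem InFoldBox.hasDerivAt {X Y : ℝ → ℝ} {ξ η s : ℝ} (h : InFoldBox (X s) (Y s))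
    (hX : HasDerivAt X ξ s) (hY : HasDerivAt Y η s) :
    (∃ a b : ℝ, Mem (2 ^ 20) a (DualZ.kite (2 ^ 20) foldBox.1 foldBox.2).phi.a ∧
      Mem (2 ^ 20) b (DualZ.kite (2 ^ 20) foldBox.1 foldBox.2).phi.b ∧
      HasDerivAt (fun r => (kiteAt (X r) (Y r)).phi) (a * ξ + b * η) s) ∧
    ∃ a b : ℝ, Mem (2 ^ 20) a (DualZ.kite (2 ^ 20) foldBox.1 foldBox.2).s.a ∧
      Mem (2 ^ 20) b (DualZ.kite (2 ^ 20) foldBox.1 foldBox.2).s.b ∧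
      HasDerivAt (fun r => (kiteAt (X r) (Y r)).s) (a * ξ + b * η) s :=
  hasDerivAt_kite (by norm_num) (by norm_num [foldBox]) (by norm_num [foldBox])
    (by norm_num [foldBox]) (by norm_num [foldBox]) h.1 h.2 hX hY

theorem eq_zero_of_mul_add_mul {a b a' b' ξ η : ℝ} (h : 0 < a * b' - b * a')
    (h1 : a * ξ + b * η = 0) (h2 : a' * ξ + b' * η = 0) : ξ = 0 ∧ η = 0 := by
  constructor
  · have : (a * b' - b * a') * ξ = 0 := by linear_combination b' * h1 - b * h2
    exact (mul_eq_zero.1 this).resolve_left h.ne'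
  · have : (a * b' - b * a') * η = 0 := by linear_combination a * h2 - a' * h1
    exact (mul_eq_zero.1 this).resolve_left h.ne'

/-- `phi` and `s` have at most one common zero in `foldBox`. -/
theorem InFoldBox.eq {x y x' y' : ℝ} (h : InFoldBox x y) (h' : InFoldBox x' y')
    (hphi : (kiteAt x y).phi = 0) (hs : (kiteAt x y).s = 0) (hphi' : (kiteAt x' y').phi = 0)
    (hs' : (kiteAt x' y').s = 0) : x' = x ∧ y' = y := by
  obtain ⟨l, r, l', r', hbox⟩ := inFoldBox_iff
  have hseg : ∀ s ∈ Set.Icc (0 : ℝ) 1, InFoldBox (x + s * (x' - x)) (y + s * (y' - y)) := by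
    intro s hs
    rw [hbox] at h h' ⊢
    have := fun (u v : ℝ) {L R : ℝ} (hu : u ∈ Set.Icc L R) (hv : v ∈ Set.Icc L R) =>
      (convex_Icc L R).add_smul_sub_mem hu hv hs
    exact ⟨this _ _ h.1 h'.1, this _ _ h.2 h'.2⟩
  have line : ∀ u v s : ℝ, HasDerivAt (fun s => u + s * (v - u)) (v - u) s := fun u v s => by
    simpa using ((hasDerivAt_id s).mul_const (v - u)).const_add u
  have key := fun s hs => (hseg s hs).hasDerivAt (line x x' s) (line y y' s)
  -- Rolle's theorem is applied to `phi` and to `s` separately, at different points of the segment;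
  -- the determinant bound over the whole box allows for such mixed rows.
  obtain ⟨s₁, m₁, e₁⟩ := exists_deriv_eq_zero (zero_lt_one' ℝ)
    (fun s hs => ((key s hs).1.choose_spec.choose_spec.2.2).continuousAt.continuousWithinAt)
    (by simp [hphi, hphi'])
  obtain ⟨s₂, m₂, e₂⟩ := exists_deriv_eq_zero (zero_lt_one' ℝ)
    (fun s hs => ((key s hs).2.choose_spec.choose_spec.2.2).continuousAt.continuousWithinAt)
    (by simp [hs, hs'])
  obtain ⟨a, b, ha, hb, hd⟩ := (key s₁ (Set.Ioo_subset_Icc_self m₁)).1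
  obtain ⟨a', b', ha', hb', hd'⟩ := (key s₂ (Set.Ioo_subset_Icc_self m₂)).2
  rw [hd.deriv] at e₁
  rw [hd'.deriv] at e₂
  have := eq_zero_of_mul_add_mul
    (transversal_det_pos (by norm_num) transversal_foldBox ha hb ha' hb') e₁ e₂
  constructor <;> linarith [this.1, this.2]

/-- The kite quantities of a point whose parameters pass a bisection test satisfy the test. -/
theorem exists_box_of_cover {P : ℤ} (hP : 0 < P) {ok : IntervalZ → IntervalZ → Bool} {n : ℕ}
    {I J : IntervalZ} (h : cover ok n I J = true) (h1 : 0 < I.lo) (h2 : I.hi ≤ P) (h3 : 0 < J.lo)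
    (h4 : J.hi ≤ P) {x y : ℝ} (hx : Mem P (param x) I) (hy : Mem P (param y) J) :
    ∃ I' J', ok I' J' = true ∧ Mem P (param x) I' ∧ Mem P (param y) J' ∧
      (kiteAt x y).Rel (Mem P) (IntervalZ.kite P I' J') := by
  obtain ⟨I', J', h5, h6, h7, h8, h9, h10, h11⟩ := cover_sound n h1 h2 h3 h4 h hx hy
  exact ⟨I', J', h5, h6, h7, kite_mem hP h8 h9 h10 h11 h6 h7⟩

/-- With z = (y - x)/b in [0, 1] and w = y/b < 1 the quantity is 2 + z³ - 3z⁴w. From z⁴w ≤ z³ it is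
at least 2 - 2z³, positive for z < 1; for z = 1 it equals 3 - 3w. -/
theorem n₁_pos {x y : ℝ} (hy : 0 < y) (hx : 0 < x) (hd : x < y) : 0 < (kiteAt x y).n₁ := by
  have hs : √(1 + y ^ 2) ^ 2 = 1 + y ^ 2 := Real.sq_sqrt (by positivity)
  have hb : 0 < √(1 + y ^ 2) := Real.sqrt_pos.2 (by positivity)
  simp only [kiteAt, RingOps.kite, RingOps.real]
  set b := √(1 + y ^ 2)
  have hyb : y < b := by nlinarith
  have h1 : (y - x) * (1 / b) ≤ 1 := by rw [mul_one_div, div_le_one hb]; linarith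
  have h0 : 0 ≤ (y - x) * (1 / b) := mul_nonneg (by linarith) (by positivity)
  have h2 : y * (1 / b) < 1 := by rw [mul_one_div, div_lt_one hb]; exact hyb
  have h3 : 0 ≤ y * (1 / b) := by positivity
  generalize hz : (y - x) * (1 / b) = z at *
  generalize y * (1 / b) = w at *
  have e : (2 : ℝ) + z * (z * z) - (y - x) * (3 * (z * (z * z) * (w * (1 / b)))) =
      2 + z ^ 3 - 3 * z ^ 4 * w := by linear_combination (-3 * z ^ 3 * w) * hz
  push_cast
  rw [e]
  have h4 : z ^ 4 ≤ z ^ 3 := pow_le_pow_of_le_one h0 h1 (by norm_num)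
  have h5 : z ^ 3 ≤ 1 := pow_le_one₀ h0 h1
  have h6 : 0 ≤ z ^ 4 := by positivity
  have h7 : z ^ 4 * w ≤ z ^ 4 := mul_le_of_le_one_right h6 h2.le
  rcases h5.lt_or_eq with h | h
  · linarith
  · have h8 : z = 1 := by
      by_contra hne
      exact (pow_lt_one₀ h0 (lt_of_le_of_ne h1 hne) (by norm_num)).ne h
    rw [h8]; linarith

theorem n₂_pos {x y : ℝ} (hx : 0 < x) (hd : x < y) : 0 < (kiteAt x y).n₂ := by
  have ha : 0 < 1 / √(1 + x ^ 2) := one_div_pos.2 (Real.sqrt_pos.2 (by positivity))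
  have hd' : 0 < y - x := by linarith
  simp only [kiteAt, RingOps.kite, RingOps.real]
  positivity

/-- A degenerate solution lies in `foldBox`. -/
theorem inFoldBox_of_phi_eq_zero {x y : ℝ} (hx : 0 < x) (hxy : x < y) (hx' : x ≤ 15 / 8)
    (hy : 3 / 4 ≤ y) (hy' : y ≤ 63 / 16) (hk : 0 < (kiteAt x y).k) (hphi : (kiteAt x y).phi = 0)
    (hs : (kiteAt x y).s = 0) : InFoldBox x y := by
  have hPx : Mem (2 ^ 20) (param x) ⟨2 ^ 18, 2 ^ 20⟩ := by
    rw [mem_param_iff (by norm_num) (by norm_num) (by norm_num)]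
    norm_num; exact ⟨hx.le, hx'⟩
  have hPy : Mem (2 ^ 20) (param y) ⟨2 ^ 17, 2 ^ 19⟩ := by
    rw [mem_param_iff (by norm_num) (by norm_num) (by norm_num)]
    norm_num; exact ⟨hy, hy'⟩
  have hP : (0 : ℤ) < 2 ^ 20 := by norm_num
  obtain ⟨I, J, hok, hI, hJ, D⟩ := exists_box_of_cover hP cover_regularOrFold (by norm_num)
    (by norm_num) (by norm_num) (by norm_num) hPx hPy
  simp only [regularOrFold, Bool.or_eq_true, Bool.and_eq_true, decide_eq_true_eq] at hok
  rcases hok with ((((h | h) | h) | h) | h) | h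
  · exact absurd hphi (pos_sound hP h D.phi).ne'
  · exact absurd hphi (neg_sound hP h D.phi).ne
  · exact absurd hs (pos_sound hP h D.s).ne'
  · exact absurd hs (neg_sound hP h D.s).ne
  -- This test serves the corner a = b = 2, where d = k = 0 makes `phi` and `s` vanish together, so
  -- that no enclosure can separate them from 0. Positivity of `k` and `d` at an actual solution
  -- then forces `s` > 0.
  · have h1 := pos_sound hP h.1 D.al
    have h2 := pos_sound hP h.2 D.be
    have h3 := n₁_pos (hx.trans hxy) hx hxy
    have h4 := n₂_pos hx hxy
    have h5 : 0 < (kiteAt x y).d := by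
      simp only [kiteAt, RingOps.kite, RingOps.real]; linarith
    have : (kiteAt x y).s = (kiteAt x y).k * ((kiteAt x y).n₁ * (kiteAt x y).be +
      (kiteAt x y).n₂ * (kiteAt x y).al) +
        (kiteAt x y).d * ((kiteAt x y).al * (kiteAt x y).be) := rfl
    have : 0 < (kiteAt x y).s := by rw [this]; positivity
    exact absurd hs this.ne'
  · obtain ⟨⟨h1, h2⟩, h3, h4⟩ := h
    have w : ∀ {z : ℝ} {I K : IntervalZ}, K.lo ≤ I.lo → I.hi ≤ K.hi → Mem (2 ^ 20) z I →
        Mem (2 ^ 20) z K := fun hl hh hz =>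
      ⟨le_trans (by exact_mod_cast hl) hz.1, hz.2.trans (by exact_mod_cast hh)⟩
    exact ⟨w h1 h2 hI, w h3 h4 hJ⟩

/-- The point `(x, y)` of heights lies in `smallBox`. -/
def InSmallBox (x y : ℝ) : Prop :=
  Mem (2 ^ 45) (param x) smallBox.1 ∧ Mem (2 ^ 45) (param y) smallBox.2

theorem InSmallBox.inFoldBox {x y : ℝ} (h : InSmallBox x y) : InFoldBox x y := by
  obtain ⟨⟨h1, h2⟩, h3, h4⟩ := h
  norm_num [smallBox] at h1 h2 h3 h4
  refine ⟨⟨?_, ?_⟩, ?_, ?_⟩ <;> norm_num [foldBox] <;> linarith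

theorem exists_box_of_cover_smallBox {ok : IntervalZ → IntervalZ → Bool} {I J : IntervalZ}
    (h : cover ok 20 I J = true) (hI : smallBox.1.lo ≤ I.lo) (hI' : I.hi ≤ smallBox.1.hi)
    (hJ : smallBox.2.lo ≤ J.lo) (hJ' : J.hi ≤ smallBox.2.hi) {x y : ℝ}
    (hx : Mem (2 ^ 45) (param x) I) (hy : Mem (2 ^ 45) (param y) J) :
    ∃ I' J', ok I' J' = true ∧ (kiteAt x y).Rel (Mem (2 ^ 45)) (IntervalZ.kite (2 ^ 45) I' J') := by
  obtain ⟨I', J', h1, -, -, h2⟩ := exists_box_of_cover (by norm_num) h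
    (lt_of_lt_of_le (by norm_num [smallBox]) hI) (hI'.trans (by norm_num [smallBox]))
    (lt_of_lt_of_le (by norm_num [smallBox]) hJ) (hJ'.trans (by norm_num [smallBox])) hx hy
  exact ⟨I', J', h1, h2⟩

theorem param_one_div_sub {t : ℝ} (ht : 0 < t) : param ((1 / t - t) / 2) = t :=
  le_antisymm ((param_le_iff ht).2 le_rfl) ((le_param_iff ht).2 le_rfl)

theorem mem_param_endpoint {n : ℤ} (hn : 0 < n) :
    Mem (2 ^ 45) (param ((1 / (n / (2 ^ 45 : ℤ) : ℝ) - n / (2 ^ 45 : ℤ)) / 2)) ⟨n, n⟩ := by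
  have : (0 : ℝ) < n := by exact_mod_cast hn
  rw [param_one_div_sub (by positivity), Mem]
  norm_num

open Set in
/-- `phi` and `s` have a common zero in `smallBox`. -/
theorem exists_zero : ∃ x y : ℝ, InSmallBox x y ∧ (kiteAt x y).phi = 0 ∧ (kiteAt x y).s = 0 := by
  have hP : (0 : ℤ) < 2 ^ 45 := by norm_num
  have p1 : 0 < smallBox.1.lo := by norm_num [smallBox]
  have p2 : 0 < smallBox.1.hi := by norm_num [smallBox]
  have p3 : 0 < smallBox.2.lo := by norm_num [smallBox]
  have p4 : 0 < smallBox.2.hi := by norm_num [smallBox]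
  have hX := fun x => mem_param_iff (x := x) hP p1 p2
  have hY := fun x => mem_param_iff (x := x) hP p3 p4
  have q1 := mem_param_endpoint p1
  have q2 := mem_param_endpoint p2
  have q3 := mem_param_endpoint p3
  have q4 := mem_param_endpoint p4
  have l1 : smallBox.1.lo ≤ smallBox.1.hi := by norm_num [smallBox]
  have l2 : smallBox.2.lo ≤ smallBox.2.hi := by norm_num [smallBox]
  have hXle : (1 / (smallBox.1.hi / (2 ^ 45 : ℤ) : ℝ) - smallBox.1.hi / (2 ^ 45 : ℤ)) / 2 ≤
      (1 / (smallBox.1.lo / (2 ^ 45 : ℤ) : ℝ) - smallBox.1.lo / (2 ^ 45 : ℤ)) / 2 := by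
    norm_num [smallBox]
  have hYle : (1 / (smallBox.2.hi / (2 ^ 45 : ℤ) : ℝ) - smallBox.2.hi / (2 ^ 45 : ℤ)) / 2 ≤
      (1 / (smallBox.2.lo / (2 ^ 45 : ℤ) : ℝ) - smallBox.2.lo / (2 ^ 45 : ℤ)) / 2 := by
    norm_num [smallBox]
  -- X₀ and Y₀ come from the upper parameter ends, so [X₀, X₁] × [Y₀, Y₁] is the box in the heights,
  -- in increasing order.
  generalize (1 / (smallBox.1.hi / (2 ^ 45 : ℤ) : ℝ) - smallBox.1.hi / (2 ^ 45 : ℤ)) / 2 = X₀ at *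
  generalize (1 / (smallBox.1.lo / (2 ^ 45 : ℤ) : ℝ) - smallBox.1.lo / (2 ^ 45 : ℤ)) / 2 = X₁ at *
  generalize (1 / (smallBox.2.hi / (2 ^ 45 : ℤ) : ℝ) - smallBox.2.hi / (2 ^ 45 : ℤ)) / 2 = Y₀ at *
  generalize (1 / (smallBox.2.lo / (2 ^ 45 : ℤ) : ℝ) - smallBox.2.lo / (2 ^ 45 : ℤ)) / 2 = Y₁ at *
  obtain ⟨Y, hYc, hYz⟩ := exists_continuousOn_zero (f := fun x y => (kiteAt x y).phi)
    (S := Icc X₀ X₁) (l := Y₀) (r := Y₁) continuous_kite.1 hYle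
    (by
      intro x hx
      have hd : ∀ y ∈ Icc Y₀ Y₁, ∃ b < 0, HasDerivAt (fun y => (kiteAt x y).phi) b y := by
        intro y hy
        obtain ⟨a, b, -, hb, h⟩ := (InFoldBox.hasDerivAt (X := fun _ => x) (Y := fun y => y)
          (InSmallBox.inFoldBox ⟨(hX x).2 hx, (hY y).2 hy⟩) (hasDerivAt_const y x)
          (hasDerivAt_id' y)).1
        exact ⟨b, transversal_phi_neg (by norm_num) transversal_foldBox hb, by simpa using h⟩
      refine strictAntiOn_of_deriv_neg (convex_Icc _ _) (fun y hy => ?_) fun y hy => ?_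
      · obtain ⟨b, -, h⟩ := hd y hy
        exact h.continuousAt.continuousWithinAt
      · obtain ⟨b, hb, h⟩ := hd y (interior_subset hy)
        rwa [h.deriv])
    (fun x hx => by
      obtain ⟨I, J, h, D⟩ := exists_box_of_cover_smallBox cover_smallBox_phi_pos le_rfl le_rfl l2
        le_rfl ((hX x).2 hx) q4
      exact pos_sound hP h D.phi)
    (fun x hx => by
      obtain ⟨I, J, h, D⟩ := exists_box_of_cover_smallBox cover_smallBox_phi_neg le_rfl le_rfl
        le_rfl l2 ((hX x).2 hx) q3
      exact neg_sound hP h D.phi)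
  -- Along the curve y = Y(x) of zeros of `phi`, `s` goes from negative to positive values.
  have hs : ContinuousOn (fun x => (kiteAt x (Y x)).s) (Icc X₀ X₁) :=
    continuous_kite.2.comp_continuousOn (continuousOn_id.prodMk hYc)
  have s0 : (kiteAt X₀ (Y X₀)).s < 0 := by
    obtain ⟨y1, y2⟩ := hYz X₀ ⟨le_rfl, hXle⟩
    obtain ⟨I, J, h, D⟩ := exists_box_of_cover_smallBox cover_smallBox_s_neg l1 le_rfl
      le_rfl le_rfl q2 ((hY _).2 y1)
    simp only [Bool.or_eq_true] at h
    rcases h with (h | h) | h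
    · exact absurd y2 (pos_sound hP h D.phi).ne'
    · exact absurd y2 (neg_sound hP h D.phi).ne
    · exact neg_sound hP h D.s
  have s1 : 0 < (kiteAt X₁ (Y X₁)).s := by
    obtain ⟨y1, y2⟩ := hYz X₁ ⟨hXle, le_rfl⟩
    obtain ⟨I, J, h, D⟩ := exists_box_of_cover_smallBox cover_smallBox_s_pos le_rfl l1
      le_rfl le_rfl q1 ((hY _).2 y1)
    simp only [Bool.or_eq_true] at h
    rcases h with (h | h) | h
    · exact absurd y2 (pos_sound hP h D.phi).ne'
    · exact absurd y2 (neg_sound hP h D.phi).ne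
    · exact pos_sound hP h D.s
  obtain ⟨x, hx, h0⟩ := intermediate_value_Icc hXle hs (show (0 : ℝ) ∈ Icc _ _ from ⟨s0.le, s1.le⟩)
  exact ⟨x, Y x, ⟨(hX x).2 hx, (hY _).2 (hYz x hx).1⟩, (hYz x hx).2, h0⟩

end ConcaveKite

/-! ### The functions `h₁`, `h₂`, their derivatives, and a priori bounds -/

namespace ConcaveKite

theorem ht_pos {a : ℝ} (ha : 1 < a) : 0 < ht a := Real.sqrt_pos.2 (by nlinarith)

theorem ht_sq {a : ℝ} (ha : 1 < a) : ht a ^ 2 = a ^ 2 - 1 := Real.sq_sqrt (by nlinarith)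

theorem sqrt_one_add_ht_sq {a : ℝ} (ha : 1 < a) : √(1 + ht a ^ 2) = a := by
  rw [ht_sq ha, show 1 + (a ^ 2 - 1) = a ^ 2 by ring, Real.sqrt_sq (by linarith)]

/-- The kite quantities at the apex distances `a` and `b`. -/
noncomputable def kd (a b : ℝ) : KiteData ℝ := RingOps.real.kite (ht a) (1 / a) (ht b) (1 / b)

theorem kiteAt_ht {a b : ℝ} (ha : 1 < a) (hb : 1 < b) : kiteAt (ht a) (ht b) = kd a b := by
  rw [kiteAt, sqrt_one_add_ht_sq ha, sqrt_one_add_ht_sq hb, kd]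

theorem hasDerivAt_ht {a : ℝ} (ha : 1 < a) : HasDerivAt ht (a / ht a) a := by
  have h1 : HasDerivAt (fun x : ℝ => x ^ 2 - 1) (2 * a) a := by
    simpa using (hasDerivAt_pow 2 a).sub_const 1
  refine (h1.sqrt (by nlinarith)).congr_deriv ?_
  rw [mul_div_mul_left _ _ two_ne_zero, ht]

theorem kd_d (a b : ℝ) : (kd a b).d = ht b - ht a := rfl

theorem kd_k (a b : ℝ) : (kd a b).k = ht a * (8 * (1 / a) ^ 3 - 1) := by
  simp only [kd, RingOps.kite, RingOps.real]; push_cast; ring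

theorem kd_q (a b : ℝ) : (kd a b).q = ht b * (1 - 8 * (1 / b) ^ 3) := by
  simp only [kd, RingOps.kite, RingOps.real]; push_cast; ring

theorem kd_k' (a b : ℝ) :
    (kd a b).k' = 8 * (1 / a) ^ 3 * (1 - 3 * (ht a * (1 / a)) ^ 2) - 1 := by
  simp only [kd, RingOps.kite, RingOps.real]; push_cast; ring

theorem kd_q' (a b : ℝ) :
    (kd a b).q' = 1 - 8 * (1 / b) ^ 3 * (1 - 3 * (ht b * (1 / b)) ^ 2) := by
  simp only [kd, RingOps.kite, RingOps.real]; push_cast; ring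

theorem kd_e (a b : ℝ) : (kd a b).e = 1 - ((ht b - ht a) * (1 / b)) ^ 3 := by
  simp only [kd, RingOps.kite, RingOps.real]; push_cast; ring

theorem kd_f (a b : ℝ) : (kd a b).f = 1 - ((ht b - ht a) * (1 / a)) ^ 3 := by
  simp only [kd, RingOps.kite, RingOps.real]; push_cast; ring

theorem kd_n₁ (a b : ℝ) : (kd a b).n₁ = 2 + ((ht b - ht a) * (1 / b)) ^ 3 -
    3 * (ht b - ht a) * (((ht b - ht a) * (1 / b)) ^ 3 * (ht b * (1 / b) * (1 / b))) := by
  simp only [kd, RingOps.kite, RingOps.real]; push_cast; ring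

theorem kd_n₂ (a b : ℝ) : (kd a b).n₂ = 2 + ((ht b - ht a) * (1 / a)) ^ 3 +
    3 * (ht b - ht a) * (((ht b - ht a) * (1 / a)) ^ 3 * (ht a * (1 / a) * (1 / a))) := by
  simp only [kd, RingOps.kite, RingOps.real]; push_cast; ring

theorem kd_phi (a b : ℝ) : (kd a b).phi = (kd a b).k * (kd a b).f - (kd a b).q * (kd a b).e := rfl

theorem kd_u₁ (a b : ℝ) :
    (kd a b).u₁ = (kd a b).k * (3 - (kd a b).e) - (kd a b).k' * (kd a b).d * (kd a b).e := by
  simp only [kd, RingOps.kite, RingOps.real]; push_cast; ring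

theorem kd_u₂ (a b : ℝ) :
    (kd a b).u₂ = (kd a b).k * (3 - (kd a b).f) + (kd a b).q' * (kd a b).d * (kd a b).e := by
  simp only [kd, RingOps.kite, RingOps.real]; push_cast; ring

theorem kd_tr (a b : ℝ) : (kd a b).tr = ht a * (1 / a) * ((kd a b).e * (kd a b).u₂) -
    ht b * (1 / b) * ((kd a b).f * (kd a b).u₁) := rfl

/-- The polynomial `s` in terms of the first derivatives of `h₁` and `h₂`. -/
theorem kd_d_mul_s (a b : ℝ) : (kd a b).d * (kd a b).s =
    (kd a b).u₁ * (kd a b).u₂ - (kd a b).k ^ 2 * (kd a b).n₁ * (kd a b).n₂ := by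
  simp only [kd, RingOps.kite, RingOps.real]; push_cast; ring

theorem den₁_eq {a b : ℝ} (hb : 1 < b) : den₁ a b = b ^ 3 * (kd a b).e := by
  have : b ≠ 0 := by linarith
  rw [den₁, kd_e]; field_simp; ring

theorem den₂_eq {a b : ℝ} (ha : 1 < a) : den₂ a b = a ^ 3 * (kd a b).f := by
  have : a ≠ 0 := by linarith
  rw [den₂, kd_f]; field_simp; ring

theorem h₁_eq {a b : ℝ} (ha : 1 < a) (hb : 1 < b) :
    h₁ a b = (kd a b).k * (kd a b).d ^ 2 / (4 * (kd a b).e) := by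
  have ha0 : a ≠ 0 := by linarith
  have hb0 : b ≠ 0 := by linarith
  rw [h₁, den₁_eq hb, ← mul_div_mul_left _ (4 * (kd a b).e)
    (mul_ne_zero (pow_ne_zero 3 ha0) (pow_ne_zero 3 hb0)), kd_k, kd_d]
  congr 1
  · field_simp; ring
  · ring

theorem h₂_eq {a b : ℝ} (ha : 1 < a) (hb : 1 < b) :
    h₂ a b = (kd a b).q * (kd a b).d ^ 2 / (4 * (kd a b).f) := by
  have ha0 : a ≠ 0 := by linarith
  have hb0 : b ≠ 0 := by linarith
  rw [h₂, den₂_eq ha, ← mul_div_mul_left _ (4 * (kd a b).f)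
    (mul_ne_zero (pow_ne_zero 3 ha0) (pow_ne_zero 3 hb0)), kd_q, kd_d]
  congr 1
  · field_simp; ring
  · ring

theorem hasDerivAt_one_div {a : ℝ} (ha : 1 < a) :
    HasDerivAt (fun a : ℝ => 1 / a) (-(1 / a ^ 2)) a := by
  simpa using hasDerivAt_inv (show a ≠ 0 by linarith)

theorem hasDerivAt_h₁_left {a b : ℝ} (ha : 1 < a) (hb : 1 < b) (he : (kd a b).e ≠ 0) :
    HasDerivAt (fun a => h₁ a b)
      (-(a / ht a * ((kd a b).d * (kd a b).u₁) / (4 * (kd a b).e ^ 2))) a := by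
  have hx := (ht_pos ha).ne'
  have ha0 : a ≠ 0 := by linarith
  have hb0 : b ≠ 0 := by linarith
  have dx := hasDerivAt_ht ha
  have dd := dx.const_sub (ht b)
  have dk := dx.fun_mul ((((hasDerivAt_one_div ha).fun_pow 3).const_mul 8).sub_const 1)
  have de := (((dd.mul_const (1 / b)).fun_pow 3).const_sub 1).const_mul 4
  have := (dk.fun_mul (dd.fun_pow 2)).fun_div de
    (mul_ne_zero four_ne_zero (by rwa [kd_e] at he))
  refine (this.congr_deriv ?_).congr_of_eventuallyEq ?_
  · rw [kd_u₁, kd_k, kd_k', kd_d, kd_e]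
    rw [kd_e] at he
    have he' := he
    -- The denominator is kept as an atom, so that `field_simp` can cancel it before it is expanded.
    generalize hE : 1 - ((ht b - ht a) * (1 / b)) ^ 3 = E at *
    push_cast
    field_simp
    subst hE
    field_simp
    ring
  · filter_upwards [lt_mem_nhds ha] with z hz
    rw [h₁_eq hz hb, kd_k, kd_d, kd_e]

theorem hasDerivAt_h₁_right {a b : ℝ} (ha : 1 < a) (hb : 1 < b) (he : (kd a b).e ≠ 0) :
    HasDerivAt (fun b => h₁ a b)
      (b / ht b * ((kd a b).d * ((kd a b).k * (kd a b).n₁)) / (4 * (kd a b).e ^ 2)) b := by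
  have hy := (ht_pos hb).ne'
  have hb0 : b ≠ 0 := by linarith
  have dd := (hasDerivAt_ht hb).sub_const (ht a)
  have de := (((dd.fun_mul (hasDerivAt_one_div hb)).fun_pow 3).const_sub 1).const_mul 4
  have := ((dd.fun_pow 2).const_mul (ht a * (8 * (1 / a) ^ 3 - 1))).fun_div de
    (mul_ne_zero four_ne_zero (by rwa [kd_e] at he))
  refine (this.congr_deriv ?_).congr_of_eventuallyEq ?_
  · rw [kd_n₁, kd_k, kd_d, kd_e]
    rw [kd_e] at he
    have he' := he
    generalize hE : 1 - ((ht b - ht a) * (1 / b)) ^ 3 = E at *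
    push_cast
    field_simp
    subst hE
    field_simp
    ring
  · filter_upwards [lt_mem_nhds hb] with z hz
    rw [h₁_eq ha hz, kd_k, kd_d, kd_e]

theorem hasDerivAt_h₂_left {a b : ℝ} (ha : 1 < a) (hb : 1 < b) (hf : (kd a b).f ≠ 0) :
    HasDerivAt (fun a => h₂ a b)
      (-(a / ht a * ((kd a b).d * ((kd a b).q * (kd a b).n₂)) / (4 * (kd a b).f ^ 2))) a := by
  have hx := (ht_pos ha).ne'
  have ha0 : a ≠ 0 := by linarith
  have dd := (hasDerivAt_ht ha).const_sub (ht b)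
  have de := (((dd.fun_mul (hasDerivAt_one_div ha)).fun_pow 3).const_sub 1).const_mul 4
  have := ((dd.fun_pow 2).const_mul (ht b * (1 - 8 * (1 / b) ^ 3))).fun_div de
    (mul_ne_zero four_ne_zero (by rwa [kd_f] at hf))
  refine (this.congr_deriv ?_).congr_of_eventuallyEq ?_
  · rw [kd_n₂, kd_q, kd_d, kd_f]
    rw [kd_f] at hf
    have hf' := hf
    generalize hE : 1 - ((ht b - ht a) * (1 / a)) ^ 3 = E at *
    push_cast
    field_simp
    subst hE
    field_simp
    ring
  · filter_upwards [lt_mem_nhds ha] with z hz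
    rw [h₂_eq hz hb, kd_q, kd_d, kd_f]

theorem hasDerivAt_h₂_right {a b : ℝ} (ha : 1 < a) (hb : 1 < b) (hf : (kd a b).f ≠ 0) :
    HasDerivAt (fun b => h₂ a b)
      (b / ht b * ((kd a b).d * ((kd a b).q' * (kd a b).d * (kd a b).f +
        (kd a b).q * (3 - (kd a b).f))) / (4 * (kd a b).f ^ 2)) b := by
  have hy := (ht_pos hb).ne'
  have ha0 : a ≠ 0 := by linarith
  have hb0 : b ≠ 0 := by linarith
  have dy := hasDerivAt_ht hb
  have dd := dy.sub_const (ht a)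
  have dq := dy.fun_mul ((((hasDerivAt_one_div hb).fun_pow 3).const_mul 8).const_sub 1)
  have de := (((dd.mul_const (1 / a)).fun_pow 3).const_sub 1).const_mul 4
  have := (dq.fun_mul (dd.fun_pow 2)).fun_div de
    (mul_ne_zero four_ne_zero (by rwa [kd_f] at hf))
  refine (this.congr_deriv ?_).congr_of_eventuallyEq ?_
  · rw [kd_q, kd_q', kd_d, kd_f]
    rw [kd_f] at hf
    have hf' := hf
    generalize hE : 1 - ((ht b - ht a) * (1 / a)) ^ 3 = E at *
    push_cast
    field_simp
    subst hE
    field_simp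
    ring
  · filter_upwards [lt_mem_nhds hb] with z hz
    rw [h₂_eq ha hz, kd_q, kd_d, kd_f]

/-- Solutions with positive mass: the point `(ht a, ht b)` is in the range where degenerate
solutions have been localized. -/
theorem solution_bounds {a b m : ℝ} (ha : 1 < a) (hb : 1 < b) (hm : 0 < m) (h1 : h₁ a b = m)
    (h2 : h₂ a b = m) :
    ht a < ht b ∧ ht a ≤ 15 / 8 ∧ 3 / 4 ≤ ht b ∧ ht b ≤ 63 / 16 ∧ 0 < (kd a b).k := by
  have hx := ht_pos ha
  have hy := ht_pos hb
  have hx2 := ht_sq ha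
  have hy2 := ht_sq hb
  have hyb : ht b < b := by nlinarith
  have ha0 : 0 < a := by linarith
  have hb0 : 0 < b := by linarith
  rw [h₁_eq ha hb] at h1
  rw [h₂_eq ha hb] at h2
  have hd0 : (kd a b).d ≠ 0 := fun h => by rw [h] at h1; simp at h1; exact hm.ne h1
  have hd2 : 0 < (kd a b).d ^ 2 := by positivity
  have hk : 0 < (kd a b).e → 0 < (kd a b).k ∧ a < 2 := fun he => by
    have h : 0 < (kd a b).k := by
      rw [← h1, div_pos_iff_of_pos_right (by positivity)] at hm
      exact pos_of_mul_pos_left hm hd2.le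
    refine ⟨h, lt_of_pow_lt_pow_left₀ 3 zero_le_two ?_⟩
    rw [kd_k, mul_pos_iff_of_pos_left hx, one_div, inv_pow, sub_pos, ← div_eq_mul_inv,
      lt_div_iff₀ (by positivity)] at h
    linarith
  have hqf : 0 < (kd a b).q / (kd a b).f := by
    have : (kd a b).q / (kd a b).f * ((kd a b).d ^ 2 / 4) = m := by
      rw [← h2, div_mul_div_comm, mul_comm 4]
    exact pos_of_mul_pos_left (this ▸ hm) (by positivity)
  rw [kd_d] at hd0
  rcases lt_or_gt_of_ne hd0 with hd | hd
  -- If y < x, both cubes are negative and e, f > 0; a positive mass then forces a < 2 < b,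
  -- contradicting y < x.
  · have neg : ∀ {u : ℝ}, 0 < u → ((ht b - ht a) * (1 / u)) ^ 3 < 0 := fun hu =>
      Odd.pow_neg (by decide) (mul_neg_of_neg_of_pos hd (by positivity))
    have he : 0 < (kd a b).e := by rw [kd_e]; linarith [neg hb0]
    have hf : 0 < (kd a b).f := by rw [kd_f]; linarith [neg ha0]
    have hq := (div_pos_iff_of_pos_right hf).1 hqf
    have hb2 : 2 < b := by
      refine lt_of_pow_lt_pow_left₀ 3 hb0.le ?_
      rw [kd_q, mul_pos_iff_of_pos_left hy, one_div, inv_pow, sub_pos, ← div_eq_mul_inv,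
        div_lt_one (by positivity)] at hq
      linarith
    have := (hk he).2
    nlinarith
  · have hxy : ht a < ht b := by linarith
    have he : 0 < (kd a b).e := by
      rw [kd_e, sub_pos, mul_one_div]
      exact pow_lt_one₀ (by positivity) ((div_lt_one hb0).2 (by linarith)) (by norm_num)
    obtain ⟨hk0, ha2⟩ := hk he
    refine ⟨hxy, by nlinarith, ?_⟩
    -- Now a < 2, so x < √3. Either q, f > 0, giving b > 2 and y < x + a < √3 + 2; or q, f < 0,
    -- giving b < 2 and y > x + a > 1.
    rcases div_pos_iff.1 hqf with ⟨hq, hf⟩ | ⟨hq, hf⟩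
    · have hb2 : 2 < b := by
        refine lt_of_pow_lt_pow_left₀ 3 hb0.le ?_
        rw [kd_q, mul_pos_iff_of_pos_left hy, one_div, inv_pow, sub_pos, ← div_eq_mul_inv,
          div_lt_one (by positivity)] at hq
        linarith
      have hda : ht b - ht a < a := by
        rw [kd_f, sub_pos, mul_one_div, pow_lt_one_iff_of_nonneg (by positivity) (by norm_num),
          div_lt_one ha0] at hf
        exact hf
      exact ⟨by nlinarith, by nlinarith, hk0⟩
    · have hb2 : b < 2 := by
        refine lt_of_pow_lt_pow_left₀ 3 zero_le_two ?_
        rw [kd_q] at hq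
        have := neg_of_mul_neg_right hq hy.le
        rw [one_div, inv_pow, sub_neg, ← div_eq_mul_inv, lt_div_iff₀ (by positivity)] at this
        linarith
      have hda : a < ht b - ht a := by
        rw [kd_f, sub_neg, mul_one_div, one_lt_pow_iff_of_nonneg (by positivity) (by norm_num),
          one_lt_div ha0] at hf
        exact hf
      exact ⟨by linarith, by nlinarith, hk0⟩

/-- On solutions, the determinant of the derivative of `(h₁, h₂)`. -/
theorem det_eq_on_solutions {A B d k q q' e f n₁ n₂ u₁ u₂ s phi : ℝ} (he : e ≠ 0) (hf : f ≠ 0)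
    (hu₂ : u₂ = k * (3 - f) + q' * d * e) (hs : d * s = u₁ * u₂ - k ^ 2 * n₁ * n₂)
    (hphi : phi = k * f - q * e) :
    -(A * (d * u₁) / (4 * e ^ 2)) * (B * (d * (q' * d * f + q * (3 - f))) / (4 * f ^ 2)) -
      B * (d * (k * n₁)) / (4 * e ^ 2) * -(A * (d * (q * n₂)) / (4 * f ^ 2)) =
    -(A * B * d ^ 3 / (16 * e ^ 3 * f)) * s +
      A * B * d ^ 2 * (u₁ * (3 - f) - k * n₁ * n₂) / (16 * e ^ 3 * f ^ 2) * phi := by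
  have h1 : -(A * B * d ^ 3 / (16 * e ^ 3 * f)) * s =
      -(A * B * d ^ 2 / (16 * e ^ 3 * f)) * (u₁ * u₂ - k ^ 2 * n₁ * n₂) := by rw [← hs]; ring
  rw [h1, hu₂, hphi]
  field_simp
  ring

end ConcaveKite

/-! ### Folds of planar systems μ = H(x) -/

namespace ParamSystem
open Filter Set

/-- The system `μ - H(x) = 0` with the same parameter in both components. -/
def diagSystem (H : (Fin 2 → ℝ) → Fin 2 → ℝ) (x : Fin 2 → ℝ) (μ : ℝ) : Fin 2 → ℝ :=
  (fun _ => μ) - H x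

/-- The Jacobian matrix of `H` at `x`. -/
noncomputable def jac (H : (Fin 2 → ℝ) → Fin 2 → ℝ) (x : Fin 2 → ℝ) : Matrix (Fin 2) (Fin 2) ℝ :=
  LinearMap.toMatrix' (fderiv ℝ H x : (Fin 2 → ℝ) →ₗ[ℝ] (Fin 2 → ℝ))

/-- The adjugate of the Jacobian matrix of `H` applied to the vector `(1, 1)`. -/
noncomputable def adjOne (H : (Fin 2 → ℝ) → Fin 2 → ℝ) (x : Fin 2 → ℝ) : Fin 2 → ℝ :=
  ![jac H x 1 1 - jac H x 0 1, jac H x 0 0 - jac H x 1 0]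

variable {H : (Fin 2 → ℝ) → Fin 2 → ℝ} {x₀ : Fin 2 → ℝ} {μ₀ : ℝ}

theorem jacobian_diagSystem (x : Fin 2 → ℝ) (μ : ℝ) : jacobian (diagSystem H) x μ = -jac H x := by
  have : fderiv ℝ (fun y => diagSystem H y μ) x = -fderiv ℝ H x := by
    simp only [diagSystem]
    exact fderiv_const_sub _
  rw [jacobian, this, jac, ← map_neg]
  rfl

theorem jac_apply (x : Fin 2 → ℝ) (i j : Fin 2) :
    jac H x i j = fderiv ℝ H x (Pi.single j 1) i := by
  rw [jac, LinearMap.toMatrix'_apply]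
  simp only [ContinuousLinearMap.coe_coe]

theorem jac_mulVec (x v : Fin 2 → ℝ) : jac H x *ᵥ v = fderiv ℝ H x v := by
  rw [jac, ← Matrix.toLin'_apply, Matrix.toLin'_toMatrix']
  rfl

theorem det_jacobian_diagSystem (x : Fin 2 → ℝ) (μ : ℝ) :
    (jacobian (diagSystem H) x μ).det = (jac H x).det := by
  rw [jacobian_diagSystem, Matrix.det_fin_two, Matrix.det_fin_two]
  simp

theorem contDiffAt_jac (hH : ContDiffAt ℝ ∞ H x₀) (i j : Fin 2) :
    ContDiffAt ℝ 1 (fun x => jac H x i j) x₀ := by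
  simp only [jac_apply]
  have h1 : ContDiffAt ℝ 1 (fderiv ℝ H) x₀ := hH.fderiv_right (by norm_cast)
  exact contDiffAt_pi.1 (h1.clm_apply contDiffAt_const) i

theorem contDiffAt_det_jac (hH : ContDiffAt ℝ ∞ H x₀) :
    ContDiffAt ℝ 1 (fun x => (jac H x).det) x₀ := by
  simp only [Matrix.det_fin_two]
  exact ((contDiffAt_jac hH 0 0).mul (contDiffAt_jac hH 1 1)).sub
    ((contDiffAt_jac hH 0 1).mul (contDiffAt_jac hH 1 0))

theorem hasStrictFDerivAt_equiv (hH : ContDiffAt ℝ 1 H x₀) (hdet : (jac H x₀).det ≠ 0) :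
    ∃ L : (Fin 2 → ℝ) ≃L[ℝ] (Fin 2 → ℝ), HasStrictFDerivAt H (L : (Fin 2 → ℝ) →L[ℝ] _) x₀ := by
  have hd : (fderiv ℝ H x₀).det ≠ 0 := by
    rwa [jac, LinearMap.det_toMatrix'] at hdet
  exact ⟨(fderiv ℝ H x₀).toContinuousLinearEquivOfDetNeZero hd,
    (hH.hasStrictFDerivAt (by simp)).congr_fderiv (by ext; simp)⟩

theorem diagSystem_eq_zero {x : Fin 2 → ℝ} {μ : ℝ} : diagSystem H x μ = 0 ↔ H x = fun _ => μ := by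
  rw [diagSystem, sub_eq_zero, eq_comm]

theorem continuous_diag : Continuous fun (μ : ℝ) (_ : Fin 2) => μ := by fun_prop

/-- Solutions with regular Jacobian matrix are not bifurcation points. -/
theorem not_isBifurcationPoint (hH : ContDiffAt ℝ 1 H x₀) (hdet : (jac H x₀).det ≠ 0) :
    ¬ IsBifurcationPoint (diagSystem H) x₀ μ₀ := by
  rintro ⟨h0, h⟩
  apply h
  obtain ⟨L, hL⟩ := hasStrictFDerivAt_equiv hH hdet
  rw [diagSystem_eq_zero] at h0
  let e := hL.toOpenPartialHomeomorph H
  have he : ∀ x, e x = H x := fun x => rfl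
  have hx : x₀ ∈ e.source := hL.mem_toOpenPartialHomeomorph_source
  have hμ : (fun _ => μ₀) ∈ e.target := h0 ▸ hL.image_mem_toOpenPartialHomeomorph_target
  refine ⟨e.source, e.open_source.mem_nhds hx, (fun (μ : ℝ) (_ : Fin 2) => μ) ⁻¹' e.target,
    continuous_diag.continuousAt.preimage_mem_nhds (e.open_target.mem_nhds hμ),
    fun μ => e.symm fun _ => μ, ?_, fun μ hm => e.map_target hm, fun μ hm x hx => ?_⟩
  · exact e.continuousOn_symm.comp continuous_diag.continuousOn fun μ hm => hm
  · rw [diagSystem_eq_zero, ← he]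
    exact (e.eq_symm_apply hx hm).symm

/-- The derivative of a continuous solution curve at a regular point. -/
theorem hasDerivAt_solution {φ : ℝ → Fin 2 → ℝ} {μ : ℝ} (hH : ContDiffAt ℝ 1 H (φ μ))
    (hdet : (jac H (φ μ)).det ≠ 0) (hφ : ContinuousAt φ μ)
    (hs : ∀ᶠ ν in 𝓝 μ, H (φ ν) = fun _ => ν) :
    ∃ φ', HasDerivAt φ φ' μ ∧ (jac H (φ μ)).det • φ' = adjOne H (φ μ) := by
  obtain ⟨L, hL⟩ := hasStrictFDerivAt_equiv hH hdet
  have hdiag : HasDerivAt (fun (ν : ℝ) (_ : Fin 2) => ν) (fun _ => 1) μ :=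
    hasDerivAt_pi.2 fun _ => hasDerivAt_id' μ
  -- A continuous solution curve agrees locally with the inverse of H along the diagonal, and so
  -- inherits its differentiability.
  have h1 : ∀ᶠ ν in 𝓝 μ, φ ν = hL.localInverse H L (φ μ) (fun _ => ν) := by
    filter_upwards [hφ.eventually hL.eventually_left_inverse, hs] with ν h2 h3
    rw [← h3, h2]
  have h2 : HasFDerivAt (hL.localInverse H L (φ μ)) (L.symm : (Fin 2 → ℝ) →L[ℝ] _)
      (fun _ => μ) := by
    have := hL.to_localInverse.hasFDerivAt
    rwa [hs.self_of_nhds] at this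
  have h3 : HasDerivAt φ (L.symm fun _ => 1) μ :=
    (h2.comp_hasDerivAt μ hdiag).congr_of_eventuallyEq h1
  refine ⟨_, h3, ?_⟩
  have h4 : jac H (φ μ) *ᵥ (L.symm fun _ => 1) = fun _ => 1 := by
    rw [jac_mulVec, hL.hasFDerivAt.fderiv]
    simp
  generalize (L.symm fun _ => 1 : Fin 2 → ℝ) = p at *
  have e0 := congrFun h4 0
  have e1 := congrFun h4 1
  simp only [Matrix.mulVec, dotProduct, Fin.sum_univ_two] at e0 e1
  ext i
  rw [Matrix.det_fin_two, adjOne]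
  fin_cases i <;> simp
  · linear_combination jac H (φ μ) 1 1 * e0 - jac H (φ μ) 0 1 * e1
  · linear_combination jac H (φ μ) 0 0 * e1 - jac H (φ μ) 1 0 * e0

/-- An isolated degenerate solution at which the Jacobian determinant has a nonzero derivative in
the direction of `adjOne` is a bifurcation point. -/
theorem isBifurcationPoint_of_fold (hH : ContDiffAt ℝ ∞ H x₀) (h0 : diagSystem H x₀ μ₀ = 0)
    (hdet : (jac H x₀).det = 0)
    (hδ : fderiv ℝ (fun x => (jac H x).det) x₀ (adjOne H x₀) ≠ 0)
    (hiso : ∀ᶠ x in 𝓝 x₀, ∀ μ, diagSystem H x μ = 0 → (jac H x).det = 0 → μ = μ₀) :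
    IsBifurcationPoint (diagSystem H) x₀ μ₀ := by
  refine ⟨h0, ?_⟩
  rintro ⟨U, hU, V, hV, φ, hc, hmaps, hφ⟩
  have hφ0 : φ μ₀ = x₀ := ((hφ μ₀ (mem_of_mem_nhds hV) x₀ (mem_of_mem_nhds hU)).1 h0).symm
  have hsol : ∀ μ ∈ V, H (φ μ) = fun _ => μ := fun μ hm =>
    diagSystem_eq_zero.1 ((hφ μ hm (φ μ) (hmaps hm)).2 rfl)
  set D : (Fin 2 → ℝ) → ℝ := fun x => (jac H x).det with hD
  set δ := fderiv ℝ D x₀ (adjOne H x₀) with hδdef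
  have hD1 : ContDiffAt ℝ 1 D x₀ := contDiffAt_det_jac hH
  have hadj : ContinuousAt (adjOne H) x₀ := by
    have hj := fun i j => (contDiffAt_jac hH i j).continuousAt
    refine continuousAt_pi.2 fun i => ?_
    fin_cases i
    · exact (hj 1 1).sub (hj 0 1)
    · exact (hj 0 0).sub (hj 1 0)
  have hκ : ContinuousAt (fun x => fderiv ℝ D x (adjOne H x)) x₀ :=
    ((hD1.fderiv_right (m := 0) (by norm_num)).continuousAt).clm_apply hadj
  have hκpos : ∀ᶠ x in 𝓝 x₀, 0 < δ * fderiv ℝ D x (adjOne H x) :=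
    (continuousAt_const.mul hκ).eventually (lt_mem_nhds (mul_self_pos.2 hδ))
  have hnear : ∀ᶠ x in 𝓝 x₀, ContDiffAt ℝ 1 H x :=
    (hH.of_le (by norm_cast) : ContDiffAt ℝ 1 H x₀).eventually (by simp)
  have hDnear : ∀ᶠ x in 𝓝 x₀, DifferentiableAt ℝ D x :=
    (hD1.eventually (by simp)).mono fun x hx => hx.differentiableAt (by simp)
  have hcont : ContinuousAt φ μ₀ := hc.continuousAt hV
  have hall : ∀ᶠ μ in 𝓝 μ₀, ContinuousAt φ μ ∧ V ∈ 𝓝 μ ∧ DifferentiableAt ℝ D (φ μ) ∧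
      (μ ≠ μ₀ → ∃ p, 0 < p ∧ HasDerivAt (fun ν => δ * D (φ ν) ^ 2) p μ) := by
    have := hφ0 ▸ ((hκpos.and (hnear.and hDnear)).and hiso)
    filter_upwards [eventually_mem_nhds_iff.2 hV, hcont.eventually this]
      with μ hμ ⟨⟨h1, h2, h3⟩, h4⟩
    refine ⟨hc.continuousAt hμ, hμ, h3, fun hne => ?_⟩
    have hm := mem_of_mem_nhds hμ
    have hdne : (jac H (φ μ)).det ≠ 0 := fun h =>
      hne (h4 μ (diagSystem_eq_zero.2 (hsol μ hm)) h)
    obtain ⟨φ', h5, h6⟩ := hasDerivAt_solution h2 hdne (hc.continuousAt hμ)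
      (by filter_upwards [hμ] with ν hν using hsol ν hν)
    have h7 : HasDerivAt (fun ν => D (φ ν)) (fderiv ℝ D (φ μ) φ') μ :=
      h3.hasFDerivAt.comp_hasDerivAt μ h5
    refine ⟨_, ?_, (h7.fun_pow 2).const_mul δ⟩
    -- By Cramer's rule D φ' = `adjOne`, so the derivative of D²/2 along the branch is the
    -- derivative of D in the direction `adjOne`, which is close to δ.
    have h8 : fderiv ℝ D (φ μ) (adjOne H (φ μ)) = D (φ μ) * fderiv ℝ D (φ μ) φ' := by
      rw [← h6, map_smul, smul_eq_mul]
    rw [h8] at h1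
    norm_num
    linarith
  obtain ⟨ε, hε, hball⟩ := Metric.eventually_nhds_iff.1 hall
  have hin : ∀ μ ∈ Icc (μ₀ - ε / 2) (μ₀ + ε / 2), dist μ μ₀ < ε := fun μ hm => by
    rw [Real.dist_eq, abs_lt]; constructor <;> linarith [hm.1, hm.2]
  have hcg : ContinuousOn (fun ν => δ * D (φ ν) ^ 2) (Icc (μ₀ - ε / 2) (μ₀ + ε / 2)) :=
    fun μ hm => by
      obtain ⟨h1, -, h2, -⟩ := hball (hin μ hm)
      have : ContinuousAt (fun ν => D (φ ν)) μ := ContinuousAt.comp (g := D) h2.continuousAt h1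
      exact (continuousAt_const.mul (this.pow 2)).continuousWithinAt
  have hder : ∀ μ ∈ Icc (μ₀ - ε / 2) (μ₀ + ε / 2), μ ≠ μ₀ →
      0 < deriv (fun ν => δ * D (φ ν) ^ 2) μ := fun μ hm hne => by
    obtain ⟨p, hp, h⟩ := (hball (hin μ hm)).2.2.2 hne
    rwa [h.deriv]
  have hl : StrictMonoOn (fun ν => δ * D (φ ν) ^ 2) (Icc (μ₀ - ε / 2) μ₀) :=
    strictMonoOn_of_deriv_pos (convex_Icc _ _) (hcg.mono (Icc_subset_Icc_right (by linarith)))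
      fun μ hm => by
        rw [interior_Icc] at hm
        exact hder μ ⟨hm.1.le, by linarith [hm.2]⟩ hm.2.ne
  have hr : StrictMonoOn (fun ν => δ * D (φ ν) ^ 2) (Icc μ₀ (μ₀ + ε / 2)) :=
    strictMonoOn_of_deriv_pos (convex_Icc _ _) (hcg.mono (Icc_subset_Icc_left (by linarith)))
      fun μ hm => by
        rw [interior_Icc] at hm
        exact hder μ ⟨by linarith [hm.1], hm.2.le⟩ hm.1.ne'
  -- δ D² increases strictly on both sides of μ₀ and vanishes there, so it would take both signs;
  -- but its sign is that of δ.
  have e1 := hl ⟨le_rfl, by linarith⟩ ⟨by linarith, le_rfl⟩ (show μ₀ - ε / 2 < μ₀ by linarith)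
  have e2 := hr ⟨le_rfl, by linarith⟩ ⟨by linarith, le_rfl⟩ (show μ₀ < μ₀ + ε / 2 by linarith)
  have hD0 : D (φ μ₀) = 0 := by rw [hφ0]; exact hdet
  simp only [hD0] at e1 e2
  have s1 := sq_nonneg (D (φ (μ₀ - ε / 2)))
  have s2 := sq_nonneg (D (φ (μ₀ + ε / 2)))
  rcases hδ.lt_or_gt with h | h
  · have := mul_nonpos_of_nonpos_of_nonneg h.le s2
    linarith
  · have := mul_nonneg h.le s1
    linarith

/-- A degenerate solution is a fold point if the Jacobian matrix has nonzero trace and the Jacobian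
determinant has a nonzero derivative in the direction of `adjOne`. -/
theorem isFoldPoint_of_deriv_det (hH : ContDiffAt ℝ ∞ H x₀) (h0 : diagSystem H x₀ μ₀ = 0)
    (hdet : (jac H x₀).det = 0) (htr : (jac H x₀).trace ≠ 0)
    (hδ : fderiv ℝ (fun x => (jac H x).det) x₀ (adjOne H x₀) ≠ 0) :
    IsFoldPoint (diagSystem H) x₀ μ₀ where
  smooth := by
    have h1 : ContDiffAt ℝ ∞ (fun p : (Fin 2 → ℝ) × ℝ => H p.1) (x₀, μ₀) :=
      hH.comp (x₀, μ₀) contDiffAt_fst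
    have h2 : ContDiffAt ℝ ∞ (fun (p : (Fin 2 → ℝ) × ℝ) (_ : Fin 2) => p.2) (x₀, μ₀) :=
      contDiffAt_pi.2 fun _ => contDiffAt_snd
    exact h2.sub h1
  isSolution := h0
  simple_zero := by
    -- With zero determinant the other eigenvalue is minus the trace, so 0 is simple exactly when
    -- the trace is nonzero.
    have h1 : (jacobian (diagSystem H) x₀ μ₀).charpoly =
        Polynomial.X * (Polynomial.X - Polynomial.C (-(jac H x₀).trace)) := by
      rw [Matrix.charpoly_fin_two, det_jacobian_diagSystem, hdet, jacobian_diagSystem,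
        Matrix.trace_neg, map_zero]
      ring
    have hne : (Polynomial.X - Polynomial.C (-(jac H x₀).trace) : Polynomial ℝ) ≠ 0 :=
      Polynomial.X_sub_C_ne_zero _
    have hX : (Polynomial.X : Polynomial ℝ).rootMultiplicity 0 = 1 := by
      simpa using Polynomial.rootMultiplicity_X_sub_C_self (x := (0 : ℝ))
    rw [h1, Polynomial.rootMultiplicity_mul (mul_ne_zero Polynomial.X_ne_zero hne), hX,
      Polynomial.rootMultiplicity_X_sub_C, if_neg (by rwa [eq_comm, neg_eq_zero])]
  nondegenerate := by
    set A := jac H x₀ with hA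
    set v := adjOne H x₀ with hv
    have hv0 : v 0 = A 1 1 - A 0 1 := rfl
    have hv1 : v 1 = A 0 0 - A 1 0 := rfl
    have hd : A 0 0 * A 1 1 - A 0 1 * A 1 0 = 0 := by rw [← Matrix.det_fin_two, hdet]
    have hvne : v ≠ 0 := fun h => hδ (by rw [h, map_zero])
    have hL : HasFDerivAt (fderiv ℝ H) (fderiv ℝ (fderiv ℝ H) x₀) x₀ :=
      ((hH.fderiv_right (m := 1) (by norm_cast)).differentiableAt (by simp)).hasFDerivAt
    -- B is the derivative of DH in the direction v, so D²H(v, v) = Bv, and the derivative of det is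
    -- tr(adj(A) B).
    set B : Matrix (Fin 2) (Fin 2) ℝ := fun i j => fderiv ℝ (fderiv ℝ H) x₀ v (Pi.single j 1) i
      with hB
    have hentry : ∀ i j, HasFDerivAt (fun x => jac H x i j) (fderiv ℝ (fun x => jac H x i j) x₀) x₀
        ∧ fderiv ℝ (fun x => jac H x i j) x₀ v = B i j := fun i j => by
      have h1 := ((contDiffAt_jac hH i j).differentiableAt (by simp)).hasFDerivAt
      refine ⟨h1, ?_⟩
      have h2 := hL.clm_apply (hasFDerivAt_const (Pi.single j 1 : Fin 2 → ℝ) x₀)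
      have h3 := ((ContinuousLinearMap.proj (R := ℝ) (φ := fun _ : Fin 2 => ℝ) i).hasFDerivAt.comp
        x₀ h2).fderiv
      have h4 : (ContinuousLinearMap.proj (R := ℝ) (φ := fun _ : Fin 2 => ℝ) i) ∘
          (fun y => (fderiv ℝ H y) (Pi.single j 1)) = fun x => jac H x i j := by
        ext x; rw [jac_apply]; rfl
      rw [h4] at h3
      rw [h3]
      simp [hB]
    have hδ' : fderiv ℝ (fun x => (jac H x).det) x₀ v =
        A 0 0 * B 1 1 + B 0 0 * A 1 1 - (A 0 1 * B 1 0 + B 0 1 * A 1 0) := by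
      simp only [Matrix.det_fin_two]
      rw [(((hentry 0 0).1.fun_mul (hentry 1 1).1).fun_sub
          ((hentry 0 1).1.fun_mul (hentry 1 0).1)).fderiv]
      simp [(hentry _ _).2]
      ring
    rw [hδ'] at hδ
    have hpd : paramDeriv (diagSystem H) x₀ μ₀ = fun _ => 1 := by
      have : HasDerivAt (fun t => diagSystem H x₀ t) (fun _ => 1) μ₀ :=
        (hasDerivAt_pi.2 fun _ => hasDerivAt_id' μ₀).sub_const (H x₀)
      rw [paramDeriv, this.deriv]
    have hsd : secondDeriv (diagSystem H) x₀ μ₀ v v = -(B *ᵥ v) := by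
      have h1 : (fun y => fderiv ℝ (fun z => diagSystem H z μ₀) y) = fun y => -fderiv ℝ H y := by
        ext1 y
        simp only [diagSystem]
        exact fderiv_const_sub _
      rw [secondDeriv, h1, hL.fun_neg.fderiv]
      have hvs : v = v 0 • Pi.single 0 1 + v 1 • Pi.single 1 1 := by
        ext i; fin_cases i <;> simp
      ext i
      have : fderiv ℝ (fderiv ℝ H) x₀ v v i = v 0 * B i 0 + v 1 * B i 1 := by
        conv_lhs => rw [hvs, map_add (fderiv ℝ (fderiv ℝ H) x₀ _)]
        rw [← hvs, map_smul, map_smul]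
        simp [hB]
      simp only [_root_.neg_apply, Pi.neg_apply, this, Matrix.mulVec, dotProduct,
        Fin.sum_univ_two]
      ring
    suffices h : ∃ w : Fin 2 → ℝ, w ≠ 0 ∧ (-A) *ᵥ v = 0 ∧ (-A)ᵀ *ᵥ w = 0 ∧
        w ⬝ᵥ (fun _ => 1) ≠ 0 ∧ w ⬝ᵥ -(B *ᵥ v) ≠ 0 by
      obtain ⟨w, h1, h2, h3, h4, h5⟩ := h
      refine ⟨v, w, hvne, h1, ?_⟩
      rw [hpd, hsd, jacobian_diagSystem]
      exact ⟨h2, h3, h4, h5⟩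
    -- Since A adj(A) = adj(A) A = 0, v = adj(A)(1, 1) is in the kernel and each row of adj(A) is a
    -- left null vector. Take for w a row with nonzero sum v i. As adj(A) has rank one, wᵀBv = v i ·
    -- tr(adj(A) B), which is nonzero.
    by_cases hz : v 0 = 0
    · have hz1 : v 1 ≠ 0 := fun h => hvne (by ext i; fin_cases i <;> simp [hz, h])
      refine ⟨![-A 1 0, A 0 0], ?_, ?_, ?_, ?_, ?_⟩
      · intro h
        apply hz1
        have e0 := congrFun h 0
        have e1 := congrFun h 1
        simp at e0 e1
        rw [hv1, e0, e1, sub_zero]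
      · ext i; fin_cases i <;> simp [Matrix.mulVec, dotProduct, Fin.sum_univ_two, hv0, hv1]
        · linear_combination -hd
        · linear_combination -hd
      · ext i; fin_cases i <;> simp [Matrix.mulVec, dotProduct, Fin.sum_univ_two]
        · ring
        · linear_combination -hd
      · simp [dotProduct, Fin.sum_univ_two]
        rw [hv1] at hz1
        intro h; apply hz1; linarith
      · have hne := mul_ne_zero hδ hz1
        intro h
        apply hne
        simp [dotProduct, Fin.sum_univ_two] at h
        simp only [hv0, hv1] at h ⊢
        linear_combination -h + (B 0 0 - B 1 0) * hd
    · refine ⟨![A 1 1, -A 0 1], ?_, ?_, ?_, ?_, ?_⟩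
      · intro h
        apply hz
        have e0 := congrFun h 0
        have e1 := congrFun h 1
        simp at e0 e1
        rw [hv0, e0, e1, sub_zero]
      · ext i; fin_cases i <;> simp [Matrix.mulVec, dotProduct, Fin.sum_univ_two, hv0, hv1]
        · linear_combination -hd
        · linear_combination -hd
      · ext i; fin_cases i <;> simp [Matrix.mulVec, dotProduct, Fin.sum_univ_two]
        · linear_combination -hd
        · ring
      · simp [dotProduct, Fin.sum_univ_two]
        rw [hv0] at hz
        intro h; apply hz; linarith
      · have hne := mul_ne_zero hδ hz
        intro h
        apply hne
        simp [dotProduct, Fin.sum_univ_two] at h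
        simp only [hv0, hv1] at h ⊢
        linear_combination -h + (B 1 1 - B 0 1) * hd

end ParamSystem

/-! ### The degenerate solution and the main theorem -/

namespace ConcaveKite
open ParamSystem Filter

/-- The map `(h₁, h₂)`. -/
noncomputable def H (r : Fin 2 → ℝ) : Fin 2 → ℝ := ![h₁ (r 0) (r 1), h₂ (r 0) (r 1)]

theorem G_eq_diagSystem : G = diagSystem H := by
  ext r m i
  fin_cases i <;> simp [G, diagSystem, H]

theorem mem_domain_iff {r : Fin 2 → ℝ} {m : ℝ} : (r, m) ∈ domain ↔
    1 < r 0 ∧ 1 < r 1 ∧ 0 < m ∧ (kd (r 0) (r 1)).e ≠ 0 ∧ (kd (r 0) (r 1)).f ≠ 0 := by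
  refine and_congr_right fun h0 => and_congr_right fun h1 => and_congr_right fun _ => ?_
  simp only at h0 h1
  have h0' : r 0 ≠ 0 := by linarith
  have h1' : r 1 ≠ 0 := by linarith
  simp only [den₁_eq h1, den₂_eq h0, mul_ne_zero_iff, ne_eq, pow_eq_zero_iff, h0', h1',
    OfNat.ofNat_ne_zero, not_false_eq_true, true_and]

theorem contDiffAt_H {r : Fin 2 → ℝ} (h0 : 1 < r 0) (h1 : 1 < r 1)
    (he : (kd (r 0) (r 1)).e ≠ 0) (hf : (kd (r 0) (r 1)).f ≠ 0) : ContDiffAt ℝ ∞ H r := by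
  have p : ∀ i, ContDiffAt ℝ ∞ (fun r : Fin 2 → ℝ => r i) r := fun i => contDiffAt_pi.1 contDiffAt_id i
  have q : ∀ i, 1 < r i → ContDiffAt ℝ ∞ (fun r : Fin 2 → ℝ => ht (r i)) r := fun i hi =>
    (((p i).pow 2).sub contDiffAt_const).sqrt (by nlinarith)
  have h0' : r 0 ≠ 0 := by linarith
  have h1' : r 1 ≠ 0 := by linarith
  have d := (q 0 h0).sub (q 1 h1)
  refine contDiffAt_pi.2 fun i => ?_
  fin_cases i
  · refine ((((((p 1).pow 3).mul (q 0 h0)).mul (((p 0).pow 3).sub contDiffAt_const)).mul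
      (d.pow 2)).neg).div ((contDiffAt_const.mul ((p 0).pow 3)).mul (((p 1).pow 3).add (d.pow 3))) ?_
    rw [den₁_eq h1]
    positivity
  · refine (((((p 0).pow 3).mul (q 1 h1)).mul (((p 1).pow 3).sub contDiffAt_const)).mul
      (d.pow 2)).div ((contDiffAt_const.mul ((p 1).pow 3)).mul (((p 0).pow 3).add (d.pow 3))) ?_
    rw [den₂_eq h0]
    positivity

/-- The Jacobian matrix of `(h₁, h₂)`. -/
theorem jac_H {r : Fin 2 → ℝ} (h0 : 1 < r 0) (h1 : 1 < r 1)
    (he : (kd (r 0) (r 1)).e ≠ 0) (hf : (kd (r 0) (r 1)).f ≠ 0) :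
    let K := kd (r 0) (r 1)
    let A := r 0 / ht (r 0)
    let B := r 1 / ht (r 1)
    jac H r 0 0 = -(A * (K.d * K.u₁) / (4 * K.e ^ 2)) ∧
    jac H r 0 1 = B * (K.d * (K.k * K.n₁)) / (4 * K.e ^ 2) ∧
    jac H r 1 0 = -(A * (K.d * (K.q * K.n₂)) / (4 * K.f ^ 2)) ∧
    jac H r 1 1 = B * (K.d * (K.q' * K.d * K.f + K.q * (3 - K.f))) / (4 * K.f ^ 2) := by
  intro K A B
  have hH := ((contDiffAt_H h0 h1 he hf).differentiableAt (by simp)).hasFDerivAt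
  have key : ∀ i j, HasDerivAt (fun t => H (Function.update r j t) i) (jac H r i j) (r j) := by
    intro i j
    rw [jac_apply]
    have h2 := hasDerivAt_update r j (r j)
    have h3 : HasFDerivAt H (fderiv ℝ H r) (Function.update r j (r j)) := by
      rwa [Function.update_eq_self]
    exact hasDerivAt_pi.1 (h3.comp_hasDerivAt (r j) h2) i
  refine ⟨?_, ?_, ?_, ?_⟩
  · exact (key 0 0).unique (by simpa [H] using hasDerivAt_h₁_left h0 h1 he)
  · exact (key 0 1).unique (by simpa [H] using hasDerivAt_h₁_right h0 h1 he)
  · exact (key 1 0).unique (by simpa [H] using hasDerivAt_h₂_left h0 h1 hf)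
  · exact (key 1 1).unique (by simpa [H] using hasDerivAt_h₂_right h0 h1 hf)

/-- The factor of `s` in the Jacobian determinant. -/
noncomputable def cs (r : Fin 2 → ℝ) : ℝ :=
  -(r 0 / ht (r 0) * (r 1 / ht (r 1)) * (kd (r 0) (r 1)).d ^ 3 /
    (16 * (kd (r 0) (r 1)).e ^ 3 * (kd (r 0) (r 1)).f))

/-- The factor of `phi` in the Jacobian determinant. -/
noncomputable def cphi (r : Fin 2 → ℝ) : ℝ :=
  r 0 / ht (r 0) * (r 1 / ht (r 1)) * (kd (r 0) (r 1)).d ^ 2 *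
    ((kd (r 0) (r 1)).u₁ * (3 - (kd (r 0) (r 1)).f) -
      (kd (r 0) (r 1)).k * (kd (r 0) (r 1)).n₁ * (kd (r 0) (r 1)).n₂) /
    (16 * (kd (r 0) (r 1)).e ^ 3 * (kd (r 0) (r 1)).f ^ 2)

/-- Retaining the `phi` term makes the identity valid off the solution curve, so that it can be
differentiated in any direction. -/
theorem det_jac_H {r : Fin 2 → ℝ} (h0 : 1 < r 0) (h1 : 1 < r 1)
    (he : (kd (r 0) (r 1)).e ≠ 0) (hf : (kd (r 0) (r 1)).f ≠ 0) :
    (jac H r).det = cs r * (kd (r 0) (r 1)).s + cphi r * (kd (r 0) (r 1)).phi := by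
  obtain ⟨e1, e2, e3, e4⟩ := jac_H h0 h1 he hf
  rw [Matrix.det_fin_two, e1, e2, e3, e4]
  exact det_eq_on_solutions he hf (kd_u₂ _ _) (kd_d_mul_s _ _) (kd_phi _ _)

/-- `phi` is proportional to `h₁ - h₂`. -/
theorem phi_eq {r : Fin 2 → ℝ} (h0 : 1 < r 0) (h1 : 1 < r 1)
    (he : (kd (r 0) (r 1)).e ≠ 0) (hf : (kd (r 0) (r 1)).f ≠ 0) (hd : (kd (r 0) (r 1)).d ≠ 0) :
    (kd (r 0) (r 1)).phi = 4 * (kd (r 0) (r 1)).e * (kd (r 0) (r 1)).f / (kd (r 0) (r 1)).d ^ 2 *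
      (H r 0 - H r 1) := by
  have e1 : H r 0 = h₁ (r 0) (r 1) := rfl
  have e2 : H r 1 = h₂ (r 0) (r 1) := rfl
  rw [e1, e2, h₁_eq h0 h1, h₂_eq h0 h1, kd_phi]
  field_simp

theorem H_eq_iff {r : Fin 2 → ℝ} {m : ℝ} :
    (H r = fun _ => m) ↔ h₁ (r 0) (r 1) = m ∧ h₂ (r 0) (r 1) = m := by
  rw [funext_iff, Fin.forall_fin_two]; rfl

/-- A degenerate solution is a common zero of `phi` and `s` in the fold box. -/
theorem degenerate_solution {r : Fin 2 → ℝ} {m : ℝ} (hr : (r, m) ∈ domain) (hG : G r m = 0)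
    (hdet : (jac H r).det = 0) :
    InFoldBox (ht (r 0)) (ht (r 1)) ∧ (kiteAt (ht (r 0)) (ht (r 1))).phi = 0 ∧
      (kiteAt (ht (r 0)) (ht (r 1))).s = 0 := by
  obtain ⟨h0, h1, hm, he, hf⟩ := mem_domain_iff.1 hr
  rw [G_eq_diagSystem, diagSystem_eq_zero] at hG
  obtain ⟨e1, e2⟩ := H_eq_iff.1 hG
  obtain ⟨b1, b2, b3, b4, b5⟩ := solution_bounds h0 h1 hm e1 e2
  have hd : (kd (r 0) (r 1)).d ≠ 0 := by rw [kd_d]; linarith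
  have hphi : (kd (r 0) (r 1)).phi = 0 := by
    rw [phi_eq h0 h1 he hf hd, hG, sub_self, mul_zero]
  have hs : (kd (r 0) (r 1)).s = 0 := by
    rw [det_jac_H h0 h1 he hf, hphi, mul_zero, add_zero] at hdet
    refine (mul_eq_zero.1 hdet).resolve_left ?_
    have := (ht_pos h0).ne'
    have := (ht_pos h1).ne'
    have : r 0 ≠ 0 := by linarith
    have : r 1 ≠ 0 := by linarith
    rw [cs, ← ne_eq, neg_ne_zero]
    positivity
  rw [← kiteAt_ht h0 h1] at b5 hphi hs
  exact ⟨inFoldBox_of_phi_eq_zero (ht_pos h0) b1 b2 b3 b4 b5 hphi hs, hphi, hs⟩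

theorem ht_injOn {a a' : ℝ} (ha : 1 < a) (ha' : 1 < a') (h : ht a = ht a') : a = a' := by
  rw [← sqrt_one_add_ht_sq ha, h, sqrt_one_add_ht_sq ha']

/-- There is at most one degenerate solution. -/
theorem degenerate_solution_unique {r r' : Fin 2 → ℝ} {m m' : ℝ} (hr : (r, m) ∈ domain)
    (hG : G r m = 0) (hdet : (jac H r).det = 0) (hr' : (r', m') ∈ domain) (hG' : G r' m' = 0)
    (hdet' : (jac H r').det = 0) : (r', m') = (r, m) := by
  obtain ⟨b, p, s⟩ := degenerate_solution hr hG hdet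
  obtain ⟨b', p', s'⟩ := degenerate_solution hr' hG' hdet'
  obtain ⟨e1, e2⟩ := b.eq b' p s p' s'
  have e0 : r' = r := by
    ext i
    fin_cases i
    · exact ht_injOn hr'.1 hr.1 e1
    · exact ht_injOn hr'.2.1 hr.2.1 e2
  subst e0
  rw [G_eq_diagSystem, diagSystem_eq_zero] at hG hG'
  rw [(H_eq_iff.1 hG).1.symm.trans (H_eq_iff.1 hG').1]

/-- At a zero of S the product rule needs only continuity of c. This spares differentiating the
factors `cs` and `cphi`. -/
theorem hasDerivAt_mul_of_eq_zero {c S : ℝ → ℝ} {S' s : ℝ} (hc : ContinuousAt c s)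
    (hS : HasDerivAt S S' s) (h0 : S s = 0) : HasDerivAt (fun t => c t * S t) (c s * S') s := by
  rw [hasDerivAt_iff_tendsto_slope] at hS ⊢
  refine ((hc.tendsto.mono_left nhdsWithin_le_nhds).mul hS).congr fun t => ?_
  simp only [slope, vsub_eq_sub, smul_eq_mul, h0, mul_zero, sub_zero]
  ring

theorem continuousAt_kite {α : Type*} [TopologicalSpace α] {x c y g : α → ℝ} {s : α}
    (hx : ContinuousAt x s) (hc : ContinuousAt c s) (hy : ContinuousAt y s)
    (hg : ContinuousAt g s) :
    let K := fun s => RingOps.real.kite (x s) (c s) (y s) (g s)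
    ContinuousAt (fun s => (K s).d) s ∧ ContinuousAt (fun s => (K s).k) s ∧
      ContinuousAt (fun s => (K s).e) s ∧ ContinuousAt (fun s => (K s).f) s ∧
      ContinuousAt (fun s => (K s).n₁) s ∧ ContinuousAt (fun s => (K s).n₂) s ∧
      ContinuousAt (fun s => (K s).u₁) s := by
  simp only [RingOps.kite, RingOps.real]
  refine ⟨?_, ?_, ?_, ?_, ?_, ?_, ?_⟩ <;> fun_prop

theorem continuous_ht : Continuous ht := by unfold ht; fun_prop

theorem continuousAt_kd {r : Fin 2 → ℝ} (h0 : r 0 ≠ 0) (h1 : r 1 ≠ 0) :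
    let K := fun r : Fin 2 → ℝ => kd (r 0) (r 1)
    ContinuousAt (fun r => (K r).d) r ∧ ContinuousAt (fun r => (K r).k) r ∧
      ContinuousAt (fun r => (K r).e) r ∧ ContinuousAt (fun r => (K r).f) r ∧
      ContinuousAt (fun r => (K r).n₁) r ∧ ContinuousAt (fun r => (K r).n₂) r ∧
      ContinuousAt (fun r => (K r).u₁) r := by
  have c : ∀ i, ContinuousAt (fun r : Fin 2 → ℝ => r i) r := fun i =>
    (continuous_apply i).continuousAt
  have d : ∀ i, ContinuousAt (fun r : Fin 2 → ℝ => ht (r i)) r := fun i =>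
    (continuous_ht.comp (continuous_apply i)).continuousAt
  exact continuousAt_kite (d 0) (continuousAt_const.div (c 0) h0) (d 1)
    (continuousAt_const.div (c 1) h1)

theorem continuousAt_cs_cphi {r : Fin 2 → ℝ} (h0 : 1 < r 0) (h1 : 1 < r 1)
    (he : (kd (r 0) (r 1)).e ≠ 0) (hf : (kd (r 0) (r 1)).f ≠ 0) :
    ContinuousAt cs r ∧ ContinuousAt cphi r := by
  obtain ⟨kd', kk, ke, kf, kn₁, kn₂, ku₁⟩ := continuousAt_kd (r := r) (by linarith) (by linarith)
  have hA : ∀ i, 1 < r i → ContinuousAt (fun r : Fin 2 → ℝ => r i / ht (r i)) r := fun i hi =>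
    (continuous_apply i).continuousAt.div
      (continuous_ht.comp (continuous_apply i)).continuousAt (ht_pos hi).ne'
  constructor
  · exact ((((hA 0 h0).mul (hA 1 h1)).mul (kd'.pow 3)).div
      ((continuousAt_const.mul (ke.pow 3)).mul kf)
      (mul_ne_zero (mul_ne_zero (by norm_num) (pow_ne_zero 3 he)) hf)).neg
  · exact ((((hA 0 h0).mul (hA 1 h1)).mul (kd'.pow 2)).mul
      ((ku₁.mul (continuousAt_const.sub kf)).sub ((kk.mul kn₁).mul kn₂))).div
      ((continuousAt_const.mul (ke.pow 3)).mul (kf.pow 2))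
      (mul_ne_zero (mul_ne_zero (by norm_num) (pow_ne_zero 3 he)) (pow_ne_zero 2 hf))

theorem ContinuousAt.line {E F : Type*} [AddCommGroup E] [Module ℝ E] [TopologicalSpace E]
    [ContinuousAdd E] [ContinuousSMul ℝ E] [TopologicalSpace F] {f : E → F} {r : E}
    (hf : ContinuousAt f r) (v : E) : ContinuousAt (fun s : ℝ => f (r + s • v)) 0 :=
  hf.comp_of_eq (by fun_prop) (by simp)

/-- At a degenerate solution the Jacobian determinant has a nonzero derivative in the direction of
`adjOne`. -/
theorem fderiv_det_ne_zero {r : Fin 2 → ℝ} {m : ℝ} (hr : (r, m) ∈ domain) (hG : G r m = 0)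
    (hdet : (jac H r).det = 0) : fderiv ℝ (fun x => (jac H x).det) r (adjOne H r) ≠ 0 := by
  obtain ⟨hbox, hphi, hs⟩ := degenerate_solution hr hG hdet
  obtain ⟨h0, h1, hm, he, hf⟩ := mem_domain_iff.1 hr
  have hHr := G_eq_diagSystem ▸ hG
  rw [diagSystem_eq_zero] at hHr
  obtain ⟨e1, e2⟩ := H_eq_iff.1 hHr
  obtain ⟨hlt, -⟩ := solution_bounds h0 h1 hm e1 e2
  have hd : (kd (r 0) (r 1)).d ≠ 0 := by rw [kd_d]; linarith
  have hx := ht_pos h0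
  have hy := ht_pos h1
  have hr0 : 0 < r 0 := by linarith
  have hr1 : 0 < r 1 := by linarith
  have hsm := contDiffAt_H h0 h1 he hf
  have hline : ∀ (v : Fin 2 → ℝ) (i), HasDerivAt (fun s : ℝ => (r + s • v) i) (v i) 0 := by
    intro v i
    simpa using ((hasDerivAt_id (0 : ℝ)).mul_const (v i)).const_add (r i)
  have hht : ∀ (v : Fin 2 → ℝ) (i), 1 < r i →
      HasDerivAt (fun s : ℝ => ht ((r + s • v) i)) (r i / ht (r i) * v i) 0 := fun v i hi =>
    (hasDerivAt_ht hi).comp_of_eq (0 : ℝ) (hline v i) (by simp)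
  obtain ⟨kd', -, ke, kf, -⟩ := continuousAt_kd hr0.ne' hr1.ne'
  have hnear : ∀ v : Fin 2 → ℝ, ∀ᶠ s : ℝ in 𝓝 0, 1 < (r + s • v) 0 ∧ 1 < (r + s • v) 1 ∧
      (kd ((r + s • v) 0) ((r + s • v) 1)).e ≠ 0 ∧ (kd ((r + s • v) 0) ((r + s • v) 1)).f ≠ 0 ∧
      (kd ((r + s • v) 0) ((r + s • v) 1)).d ≠ 0 := by
    intro v
    have c : Tendsto (fun s : ℝ => r + s • v) (𝓝 0) (𝓝 r) := by
      simpa [ContinuousAt] using ContinuousAt.line (continuousAt_id (x := r)) v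
    have c0 := fun i => (continuous_apply (A := fun _ : Fin 2 => ℝ) i).continuousAt (x := r)
    filter_upwards [c.eventually ((c0 0).eventually (lt_mem_nhds h0)),
      c.eventually ((c0 1).eventually (lt_mem_nhds h1)), c.eventually (ke.eventually_ne he),
      c.eventually (kf.eventually_ne hf), c.eventually (kd'.eventually_ne hd)]
      with s a0 a1 a2 a3 a4 using ⟨a0, a1, a2, a3, a4⟩
  have hphid : ∀ v : Fin 2 → ℝ,
      HasDerivAt (fun s : ℝ => (kiteAt (ht ((r + s • v) 0)) (ht ((r + s • v) 1))).phi)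
        (4 * (kd (r 0) (r 1)).e * (kd (r 0) (r 1)).f / (kd (r 0) (r 1)).d ^ 2 *
          ((jac H r 0 0 - jac H r 1 0) * v 0 + (jac H r 0 1 - jac H r 1 1) * v 1)) 0 := by
    intro v
    have hH : HasDerivAt (fun s : ℝ => H (r + s • v)) (fderiv ℝ H r v) 0 :=
      (hsm.differentiableAt (by simp)).hasFDerivAt.hasLineDerivAt v
    have hH' := (hasDerivAt_pi.1 hH 0).fun_sub (hasDerivAt_pi.1 hH 1)
    have hc : ContinuousAt (fun r : Fin 2 → ℝ =>
        4 * (kd (r 0) (r 1)).e * (kd (r 0) (r 1)).f / (kd (r 0) (r 1)).d ^ 2) r :=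
      ((continuousAt_const.mul ke).mul kf).div (kd'.pow 2) (pow_ne_zero 2 hd)
    have := hasDerivAt_mul_of_eq_zero (ContinuousAt.line hc v) hH' (by simp [hHr])
    refine (this.congr_deriv ?_).congr_of_eventuallyEq ?_
    · rw [← jac_mulVec]
      simp only [zero_smul, add_zero, Matrix.mulVec, dotProduct, Fin.sum_univ_two]
      ring
    · filter_upwards [hnear v] with s ⟨a0, a1, a2, a3, a4⟩
      rw [kiteAt_ht a0 a1, phi_eq a0 a1 a2 a3 a4]
  have hbd := fun v : Fin 2 → ℝ => InFoldBox.hasDerivAt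
    (X := fun s : ℝ => ht ((r + s • v) 0)) (Y := fun s : ℝ => ht ((r + s • v) 1))
    (by simpa using hbox) (hht v 0 h0) (hht v 1 h1)
  set v := adjOne H r with hv
  have hv0 : v 0 = jac H r 1 1 - jac H r 0 1 := rfl
  have hv1 : v 1 = jac H r 0 0 - jac H r 1 0 := rfl
  -- Up to nonzero factors, v 0 is the partial derivative of `phi` in y, negative on the box.
  have hvne : v 0 ≠ 0 := by
    obtain ⟨a, b, -, hb, h⟩ := (hbd (Pi.single 1 1)).1
    have hb' := transversal_phi_neg (by norm_num) transversal_foldBox hb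
    have := h.unique (hphid (Pi.single 1 1))
    simp only [Fin.isValue, ne_eq, zero_ne_one, not_false_eq_true,
      Pi.single_eq_of_ne, Pi.single_eq_same, mul_zero, mul_one, zero_add] at this
    intro hz
    rw [show jac H r 0 1 - jac H r 1 1 = -v 0 by rw [hv0]; ring, hz, neg_zero, mul_zero] at this
    exact (mul_ne_zero hb'.ne (by positivity)) this
  obtain ⟨⟨a, b, ha, hb, hp⟩, a', b', ha', hb', hsd⟩ := hbd v
  -- v is annihilated by the difference of the rows of DH, so it is tangent to `phi` = 0.
  have hp0 := hp.unique (hphid v)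
  rw [show (jac H r 0 0 - jac H r 1 0) * v 0 + (jac H r 0 1 - jac H r 1 1) * v 1 = 0 by
    rw [hv0, hv1]; ring, mul_zero] at hp0
  obtain ⟨hcs, hcphi⟩ := continuousAt_cs_cphi h0 h1 he hf
  have hD1 := (hasDerivAt_mul_of_eq_zero (ContinuousAt.line hcs v) hsd
    (by simpa using hs)).fun_add
    (hasDerivAt_mul_of_eq_zero (ContinuousAt.line hcphi v) hp (by simpa using hphi))
  have hD2 : HasDerivAt (fun s : ℝ => (jac H (r + s • v)).det)
      (fderiv ℝ (fun x => (jac H x).det) r v) 0 :=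
    ((contDiffAt_det_jac hsm).differentiableAt (by simp)).hasFDerivAt.hasLineDerivAt v
  have hD3 := hD2.unique (hD1.congr_of_eventuallyEq (by
    filter_upwards [hnear v] with s ⟨a0, a1, a2, a3, a4⟩
    rw [det_jac_H a0 a1 a2 a3, kiteAt_ht a0 a1]))
  rw [hD3, hp0, mul_zero, add_zero]
  refine mul_ne_zero ?_ fun hz => ?_
  · simp only [zero_smul, add_zero]
    rw [cs, neg_ne_zero]
    positivity
  -- If `s` were stationary along v as well, nonsingularity of D(phi, s) would make the velocity
  -- vanish, against v 0 ≠ 0.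
  · have := (eq_zero_of_mul_add_mul (transversal_det_pos (by norm_num) transversal_foldBox
      ha hb ha' hb') hp0 hz).1
    exact (mul_ne_zero (by positivity) hvne) this

/-- On `phi` = 0 one may substitute q = kf/e, after which the trace is an explicit nonzero multiple
of `tr`. -/
theorem trace_jac_H {r : Fin 2 → ℝ} {m : ℝ} (hr : (r, m) ∈ domain) (hG : G r m = 0)
    (hd : (kd (r 0) (r 1)).d ≠ 0) (htr : (kd (r 0) (r 1)).tr ≠ 0) : (jac H r).trace ≠ 0 := by
  obtain ⟨h0, h1, hm, he, hf⟩ := mem_domain_iff.1 hr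
  obtain ⟨e1, -, -, e4⟩ := jac_H h0 h1 he hf
  rw [G_eq_diagSystem, diagSystem_eq_zero] at hG
  have hphi : (kd (r 0) (r 1)).phi = 0 := by
    rw [phi_eq h0 h1 he hf hd, hG, sub_self, mul_zero]
  rw [kd_phi] at hphi
  have hx := (ht_pos h0).ne'
  have hy := (ht_pos h1).ne'
  have hr0 : r 0 ≠ 0 := by linarith
  have hr1 : r 1 ≠ 0 := by linarith
  have hq : (kd (r 0) (r 1)).q = (kd (r 0) (r 1)).k * (kd (r 0) (r 1)).f / (kd (r 0) (r 1)).e := by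
    rw [eq_div_iff he]; linarith
  have key : (jac H r).trace = (kd (r 0) (r 1)).tr * (r 0 * r 1 * (kd (r 0) (r 1)).d /
      (4 * ht (r 0) * ht (r 1) * (kd (r 0) (r 1)).e ^ 2 * (kd (r 0) (r 1)).f)) := by
    rw [Matrix.trace_fin_two, e1, e4, kd_tr, kd_u₂, hq]
    field_simp
    ring
  rw [key]
  positivity

/-- The degenerate solution exists, and lies where it is claimed to be. -/
theorem exists_degenerate_solution : ∃ (r : Fin 2 → ℝ) (m : ℝ), (r, m) ∈ domain ∧ G r m = 0 ∧
    (jac H r).det = 0 ∧ (jac H r).trace ≠ 0 ∧ |r 0 - 1.17338| ≤ 5 / 10 ^ 6 ∧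
    |r 1 - 2.03699| ≤ 5 / 10 ^ 6 ∧ |m - 1.00271| ≤ 5 / 10 ^ 6 := by
  obtain ⟨x, y, ⟨bx, bY⟩, hphi, hs⟩ := exists_zero
  obtain ⟨I, J, hok, K⟩ := exists_box_of_cover_smallBox cover_nearFold le_rfl le_rfl le_rfl le_rfl
    bx bY
  have hP : (0 : ℤ) < 2 ^ 45 := by norm_num
  have rr := IntervalZ.rel hP
  simp only [nearFold, Bool.and_eq_true] at hok
  obtain ⟨⟨⟨⟨⟨⟨o1, o2⟩, o3⟩, o4⟩, o5⟩, o6⟩, o7⟩ := hok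
  have pd := IntervalZ.pos_sound hP o1 K.d
  have pk := IntervalZ.pos_sound hP o2 K.k
  have pe := IntervalZ.pos_sound hP o3 K.e
  have pf := IntervalZ.pos_sound hP o4 K.f
  have pt := IntervalZ.pos_sound hP o5 K.tr
  have hn := rr.mul (rr.cst 1000000) (rr.mul K.k (rr.mul K.d K.d))
  have p6 := IntervalZ.pos_sound hP o6 (rr.sub hn (rr.mul (rr.cst (4 * 1002705)) K.e))
  have p7 := IntervalZ.neg_sound hP o7 (rr.sub hn (rr.mul (rr.cst (4 * 1002715)) K.e))
  have mx := (IntervalZ.mem_param_iff hP (by norm_num [smallBox]) (by norm_num [smallBox])).1 bx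
  have my := (IntervalZ.mem_param_iff hP (by norm_num [smallBox]) (by norm_num [smallBox])).1 bY
  obtain ⟨bx1, bx2⟩ := bx
  obtain ⟨by1, by2⟩ := bY
  obtain ⟨mx1, mx2⟩ := mx
  obtain ⟨my1, my2⟩ := my
  norm_num [smallBox] at mx1 mx2 my1 my2 bx1 bx2 by1 by2
  have hx0 : 0 < x := by linarith
  have hy0 : 0 < y := by linarith
  -- The apex distance is the parameter plus the height, so the rational bounds on these two add up
  -- to bounds on a and b.
  have ex : √(1 + x ^ 2) = IntervalZ.param x + x := by rw [IntervalZ.param]; ring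
  have ey : √(1 + y ^ 2) = IntervalZ.param y + y := by rw [IntervalZ.param]; ring
  have hht : ∀ z : ℝ, 0 < z → ht √(1 + z ^ 2) = z := fun z hz => by
    rw [ht, Real.sq_sqrt (by positivity), add_sub_cancel_left, Real.sqrt_sq hz.le]
  have h1lt : ∀ z : ℝ, 0 < z → 1 < √(1 + z ^ 2) := fun z hz =>
    Real.lt_sqrt_of_sq_lt (by nlinarith)
  set a := √(1 + x ^ 2)
  set b := √(1 + y ^ 2)
  have ha := h1lt x hx0
  have hb := h1lt y hy0
  have hK : kiteAt x y = kd a b := by rw [← kiteAt_ht ha hb, hht x hx0, hht y hy0]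
  rw [hK] at hphi hs pd pk pe pf pt p6 p7
  have hm := h₁_eq ha hb
  have hmpos : 0 < h₁ a b := by rw [hm]; positivity
  have hdom : (![a, b], h₁ a b) ∈ domain :=
    mem_domain_iff.2 ⟨ha, hb, hmpos, pe.ne', pf.ne'⟩
  have hG : G ![a, b] (h₁ a b) = 0 := by
    rw [G_eq_diagSystem, diagSystem_eq_zero, H_eq_iff]
    refine ⟨rfl, ?_⟩
    have := phi_eq (r := ![a, b]) ha hb pe.ne' pf.ne' pd.ne'
    simp only [Matrix.cons_val_zero, Matrix.cons_val_one] at this ⊢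
    rw [hphi, eq_comm, mul_eq_zero, sub_eq_zero] at this
    exact (this.resolve_left (by positivity)).symm
  refine ⟨![a, b], h₁ a b, hdom, hG, ?_, trace_jac_H hdom hG pd.ne' pt.ne', ?_, ?_, ?_⟩
  · rw [det_jac_H (r := ![a, b]) ha hb pe.ne' pf.ne']
    simp [hphi, hs]
  · simp only [Matrix.cons_val_zero]
    rw [abs_le]
    constructor <;> norm_num <;> linarith
  · simp only [Matrix.cons_val_one]
    rw [abs_le]
    constructor <;> norm_num <;> linarith
  · simp only [RingOps.real] at p6 p7
    push_cast at p6 p7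
    have l1 : (1.002705 : ℝ) ≤ h₁ a b := by
      rw [hm, le_div_iff₀ (by positivity)]; linarith
    have l2 : h₁ a b ≤ (1.002715 : ℝ) := by
      rw [hm, div_le_iff₀ (by positivity)]; linarith
    rw [abs_le]
    constructor <;> norm_num at * <;> linarith

end ConcaveKite

open ConcaveKite ParamSystem

theorem mainTheorem3 :
    ∃ (r₀ : Fin 2 → ℝ) (m₀ : ℝ),
      |r₀ 0 - 1.17338| ≤ 5 / 10 ^ 6 ∧ |r₀ 1 - 2.03699| ≤ 5 / 10 ^ 6 ∧
      |m₀ - 1.00271| ≤ 5 / 10 ^ 6 ∧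
      {p ∈ ConcaveKite.domain | ConcaveKite.G p.1 p.2 = 0 ∧
        (ParamSystem.jacobian ConcaveKite.G p.1 p.2).det = 0} = {(r₀, m₀)} ∧
      ParamSystem.IsFoldPoint ConcaveKite.G r₀ m₀ ∧
      {p ∈ ConcaveKite.domain | ParamSystem.IsBifurcationPoint ConcaveKite.G p.1 p.2} =
        {(r₀, m₀)} := by
  obtain ⟨r, m, hdom, hG, hdet, htr, ha, hb, hm⟩ := exists_degenerate_solution
  have hdetG : ∀ x μ, (jacobian G x μ).det = (jac H x).det := fun x μ => by
    rw [G_eq_diagSystem, det_jacobian_diagSystem]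
  obtain ⟨h0, h1, hm0, he, hf⟩ := mem_domain_iff.1 hdom
  have hsm := contDiffAt_H h0 h1 he hf
  have hδ := fderiv_det_ne_zero hdom hG hdet
  have hG' := hG
  rw [G_eq_diagSystem] at hG'
  have hH := H_eq_iff.1 (diagSystem_eq_zero.1 hG')
  refine ⟨r, m, ha, hb, hm, ?_, ?_, ?_⟩
  · refine Set.eq_singleton_iff_unique_mem.2 ⟨⟨hdom, hG, by rw [hdetG]; exact hdet⟩, ?_⟩
    rintro ⟨r', m'⟩ ⟨hd', hG', hdet'⟩
    exact degenerate_solution_unique hdom hG hdet hd' hG' (by rwa [hdetG] at hdet')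
  · rw [G_eq_diagSystem]
    exact isFoldPoint_of_deriv_det hsm hG' hdet htr hδ
  · refine Set.eq_singleton_iff_unique_mem.2 ⟨⟨hdom, ?_⟩, ?_⟩
    · rw [G_eq_diagSystem]
      refine isBifurcationPoint_of_fold hsm hG' hdet hδ ?_
      have c : ∀ i, Filter.Tendsto (fun x : Fin 2 → ℝ => x i) (𝓝 r) (𝓝 (r i)) := fun i =>
        (continuous_apply i).continuousAt
      have hc := continuousAt_pi.1 hsm.continuousAt 0
      have hht := continuous_ht
      have c1 : Continuous fun x : Fin 2 → ℝ => den₁ (x 0) (x 1) := by unfold den₁; fun_prop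
      have c2 : Continuous fun x : Fin 2 → ℝ => den₂ (x 0) (x 1) := by unfold den₂; fun_prop
      -- Uniqueness of degenerate solutions holds only in the domain. Nearby solutions stay there,
      -- their mass being `h₁`, which is continuous and positive at the fold.
      filter_upwards [(c 0).eventually (lt_mem_nhds h0), (c 1).eventually (lt_mem_nhds h1),
        hc.eventually (lt_mem_nhds (show 0 < H r 0 from hm0.trans_eq hH.1.symm)),
        c1.continuousAt.eventually_ne hdom.2.2.2.1, c2.continuousAt.eventually_ne hdom.2.2.2.2]
        with x x0 x1 xH xe xf μ hμ hd
      have hμ1 := (H_eq_iff.1 (diagSystem_eq_zero.1 hμ)).1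
      have hμ0 : 0 < μ := hμ1 ▸ xH
      exact (Prod.ext_iff.1 (degenerate_solution_unique hdom hG hdet
        (r' := x) (m' := μ) ⟨x0, x1, hμ0, xe, xf⟩ (by rwa [G_eq_diagSystem]) hd)).2
    · rintro ⟨r', m'⟩ ⟨hd', hbif⟩
      refine degenerate_solution_unique hdom hG hdet hd' hbif.1 ?_
      by_contra hne
      obtain ⟨k0, k1, -, ke, kf⟩ := mem_domain_iff.1 hd'
      rw [G_eq_diagSystem] at hbif
      exact not_isBifurcationPoint
        ((contDiffAt_H k0 k1 ke kf).of_le (by norm_cast)) hne hbif
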